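/- Let $\mathfrak g$ be a simple Lie algebra of type $E_8$ over an algebraically closed field $k$ of characteristic zero. Let $\mathfrak h$ be a Cartan subalgebra of $\mathfrak g$, $R$ the root system, $\Pi=\{\alpha_1,\dots,\alpha_8\}$ a base of $R$ in the Bourbaki numbering (the Dynkin diagram is the chain $\alpha_1,\alpha_3,\alpha_4,\alpha_5,\alpha_6,\alpha_7,\alpha_8$ with $\alpha_2$ attached to $\alpha_4$), and $R^{+}$, $R^-$ the positive and negative roots. For $S\subset\Pi$ put $R_S=\mathbb ZS\cap R$, $R_S^{\pm}=R_S\cap R^{\pm}$ and $\mathfrak p_S^{\pm}=\mathfrak h\oplus\bigoplus_{\alpha\in R_S\cup R^{\pm}}\mathfrak g_\alpha$. For $S,T\subset\Pi$ let $$\mathfrak q_{S,T}=\mathfrak p_S^-\cap\mathfrak p_T^+,\quad \mathfrak l_{S,T}=\mathfrak h\oplus\bigoplus_{\alpha\in R_{S\cap T}}\mathfrak g_\alpha,\quad \mathfrak n^+_{S,T}=\bigoplus_{\alpha\in R_S^+\setminus R_{S\cap T}}\mathfrak g_\alpha,\quad \mathfrak n^-_{S,T}=\bigoplus_{\alpha\in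 R_T^-\setminus R_{S\cap T}}\mathfrak g_\alpha,$$ so that $\mathfrak n_{S,T}=\mathfrak n^+_{S,T}\oplus\mathfrak n^-_{S,T}$ is the nilpotent radical of $\mathfrak q_{S,T}$, and put $\mathfrak p^+_{S,T}=\mathfrak l_{S,T}\oplus\mathfrak n^+_{S,T}$, with nilpotent radical $\mathfrak n^+_{S,T}$. A seaweed Lie algebra in $\mathfrak g$ is an intersection $\mathfrak p\cap\mathfrak p'$ of two parabolic subalgebras with $\mathfrak p+\mathfrak p'=\mathfrak g$. A Richardson element of $\mathfrak q_{S,T}$ (respectively of $\mathfrak p^+_{S,T}$) is an element $x\in\mathfrak n_{S,T}$ with $[x,\mathfrak q_{S,T}]=\mathfrak n_{S,T}$ (respectively an element $x\in\mathfrak n^+_{S,T}$ with $[x,\mathfrak p^+_{S,T}]=\mathfrak n^+_{S,T}$). Let $S=\Pi\setminus\{\alpha_8\}$ and $T=\Pi\setminus\{\alpha_4,\alpha_5\}$. Then $\mathfrak q_{S,T}$ is a seaweed Lie algebra in $\mathfrak g$ that has no Richardson element. Moreover $\dim\mathfrak n^-_{S,T}=3$, the parabolic part $\mathfrak p^+_{S,T}$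 has a Richardson element, and for every Richardson element $x_+$ of $\mathfrak p^+_{S,T}$ and every $x_-\in\mathfrak n^-_{S,T}$, $$\dim\,[x_-,\mathfrak q_{S,T}^{x_+}]\le 2,\qquad\text{where }\ \mathfrak q_{S,T}^{x_+}=\{z\in\mathfrak q_{S,T} : [z,x_+]=0\}.$$ -/

import Mathlib

open Module LieAlgebra LieAlgebra.IsKilling

noncomputable section

namespace Seaweed

section General

variable (k : Type*) {g : Type*} [Field k] [LieRing g] [LieAlgebra k g]

/-- A Borel subalgebra: a maximal solvable Lie subalgebra. -/
def IsBorel (B : LieSubalgebra k g) : Prop :=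
  Maximal (fun B' : LieSubalgebra k g => LieAlgebra.IsSolvable B') B

/-- A parabolic subalgebra: a Lie subalgebra that contains a Borel subalgebra. -/
def IsParabolic (p : LieSubalgebra k g) : Prop :=
  ∃ B : LieSubalgebra k g, IsBorel k B ∧ B ≤ p

/-- A seaweed Lie algebra in `g`: the intersection of two parabolic subalgebras `p`, `p'` that
are weakly opposite, that is, `p + p' = g`. -/
def IsSeaweed (q : LieSubalgebra k g) : Prop :=
  ∃ p p' : LieSubalgebra k g, IsParabolic k p ∧ IsParabolic k p' ∧
    p.toSubmodule ⊔ p'.toSubmodule = ⊤ ∧ q = p ⊓ p'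

/-- `x` is a Richardson element of a subalgebra `q` with nilpotent radical `n`:
`x ∈ n` and `[x, q] = n`. -/
def IsRichardson (q n : Submodule k g) (x : g) : Prop :=
  x ∈ n ∧ q.map (LieAlgebra.ad k g x : g →ₗ[k] g) = n

end General

section Standard

variable {k g : Type*} [Field k] [CharZero k] [LieRing g] [LieAlgebra k g] [FiniteDimensional k g]
  [IsKilling k g] {H : LieSubalgebra k g} [H.IsCartanSubalgebra]
  [LieModule.IsTriangularizable k H g]

/-- The sum of the root spaces `g_β`, `β ∈ Φ`. -/
def rootSum (Φ : Set H.root) : Submodule k g :=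
  ⨆ β ∈ Φ, (rootSpace H (β : LieModule.Weight k H g)).toSubmodule

variable (b : (rootSystem H).Base)

/-- `R_S = ℤS ∩ R`, for a set `S` of simple roots. -/
def rootsOf (S : Set b.support) : Set H.root :=
  {β | (rootSystem H).root β ∈
    Submodule.span ℤ ((fun i : b.support => (rootSystem H).root i) '' S)}

/-- The set `R⁺` of positive roots. -/
def posRoots : Set H.root := {β | b.IsPos β}

/-- The set `R⁻` of negative roots, that is, of the roots that are not positive. -/
def negRoots : Set H.root := {β | ¬ b.IsPos β}

/-! ### The standard parabolic subalgebras are closed under the bracket -/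

/-- `Φ` is closed: a root that is the sum of two elements of `Φ` lies in `Φ`. -/
def IsClosedRoots (Φ : Set H.root) : Prop :=
  ∀ β ∈ Φ, ∀ γ ∈ Φ, ∀ δ : H.root,
    (rootSystem H).root δ = (rootSystem H).root β + (rootSystem H).root γ → δ ∈ Φ

theorem exists_coeff (β : H.root) : ∃ f : H.root → ℤ,
    (rootSystem H).root β = ∑ j ∈ b.support, f j • (rootSystem H).root j ∧
    (b.IsPos β → ∀ j, 0 ≤ f j) ∧ (¬ b.IsPos β → ∀ j, f j ≤ 0) := by
  obtain ⟨f, -, h1, h2⟩ := b.exists_root_eq_sum_int β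
  refine ⟨f, h2, fun h => ?_, fun h => ?_⟩
  · rcases h1 with h1 | h1
    · exact h1.le
    · rw [RootPairing.Base.isPos_iff, b.height_eq_sum h2] at h
      exact absurd (Finset.sum_nonpos fun j _ => h1.le j) (not_le.2 h)
  · rcases h1 with h1 | h1
    · rw [RootPairing.Base.isPos_iff', b.height_eq_sum h2] at h
      exact absurd (Finset.sum_nonneg fun j _ => h1.le j) h
    · exact h1.le

theorem repr_eq {β : H.root} {f : H.root → ℤ}
    (h : (rootSystem H).root β = ∑ j ∈ b.support, f j • (rootSystem H).root j) (i : b.support) :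
    b.toWeightBasis.repr ((rootSystem H).root β) i = (f i : k) := by
  have h' : (rootSystem H).root β = ∑ j : b.support, (f j : k) • b.toWeightBasis j := by
    rw [h, ← b.support.sum_coe_sort]
    refine Finset.sum_congr rfl fun j _ => ?_
    rw [RootPairing.Base.toWeightBasis_apply]
    exact (Int.cast_smul_eq_zsmul k _ _).symm
  rw [h', b.toWeightBasis.repr_sum_self]

theorem repr_eq_zero {S : Set b.support} {β : H.root} (h : β ∈ rootsOf b S) (i : b.support)
    (hi : i ∉ S) : b.toWeightBasis.repr ((rootSystem H).root β) i = 0 := by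
  change _ ∈ Submodule.span ℤ _ at h
  generalize (rootSystem H).root β = v at h
  induction h using Submodule.span_induction with
  | mem x hx =>
    obtain ⟨j, hj, rfl⟩ := hx
    have : j ≠ i := fun e => hi (e ▸ hj)
    change b.toWeightBasis.repr ((rootSystem H).root j) i = 0
    rw [RootPairing.Base.toWeightBasis_repr_root, Finsupp.single_eq_of_ne this.symm]
  | zero => simp
  | add x y _ _ hx hy => simp [hx, hy]
  | smul a x _ hx => simp [hx]

theorem mem_rootsOf {S : Set b.support} {β : H.root}
    (h : ∀ i : b.support, i ∉ S → b.toWeightBasis.repr ((rootSystem H).root β) i = 0) :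
    β ∈ rootsOf b S := by
  obtain ⟨f, hf, -⟩ := exists_coeff b β
  change _ ∈ Submodule.span ℤ _
  rw [hf, ← b.support.sum_coe_sort]
  refine Submodule.sum_mem _ fun i _ => ?_
  by_cases hi : i ∈ S
  · exact Submodule.smul_mem _ _ (Submodule.subset_span ⟨i, hi, rfl⟩)
  · have h0 := h i hi
    rw [repr_eq b hf] at h0
    have h1 : f i = 0 := by exact_mod_cast h0
    simp [h1]

theorem mem_rootsOf_of_add {S : Set b.support} {β γ δ : H.root} (hβ : β ∈ rootsOf b S)
    (h : (rootSystem H).root δ = (rootSystem H).root β + (rootSystem H).root γ)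
    (hs : b.IsPos γ ∧ ¬ b.IsPos δ ∨ ¬ b.IsPos γ ∧ b.IsPos δ) : δ ∈ rootsOf b S := by
  refine mem_rootsOf b fun i hi => ?_
  obtain ⟨f, hf, hf1, hf2⟩ := exists_coeff b γ
  obtain ⟨f', hf', hf1', hf2'⟩ := exists_coeff b δ
  have e : b.toWeightBasis.repr ((rootSystem H).root δ) i
      = b.toWeightBasis.repr ((rootSystem H).root γ) i := by
    rw [h, map_add, Finsupp.add_apply, repr_eq_zero b hβ i hi, zero_add]
  rw [repr_eq b hf] at e
  rw [repr_eq b hf'] at e ⊢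
  have e' : f' i = f i := by exact_mod_cast e
  rcases hs with ⟨h1, h2⟩ | ⟨h1, h2⟩
  · have := hf1 h1 i
    have := hf2' h2 i
    have : f' i = 0 := by omega
    simp [this]
  · have := hf2 h1 i
    have := hf1' h2 i
    have : f' i = 0 := by omega
    simp [this]

theorem rootsOf_add {S : Set b.support} {β γ δ : H.root} (hβ : β ∈ rootsOf b S)
    (hγ : γ ∈ rootsOf b S)
    (h : (rootSystem H).root δ = (rootSystem H).root β + (rootSystem H).root γ) :
    δ ∈ rootsOf b S := by
  change _ ∈ Submodule.span ℤ _
  rw [h]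
  exact Submodule.add_mem _ hβ hγ

theorem isClosed_pos (S : Set b.support) : IsClosedRoots (rootsOf b S ∪ posRoots b) := by
  intro β hβ γ hγ δ h
  by_cases hδ : b.IsPos δ
  · exact Or.inr hδ
  left
  rcases hβ with hβ | hβ <;> rcases hγ with hγ | hγ
  · exact rootsOf_add b hβ hγ h
  · exact mem_rootsOf_of_add b hβ h (Or.inl ⟨hγ, hδ⟩)
  · exact mem_rootsOf_of_add b hγ (by rw [h, add_comm]) (Or.inl ⟨hβ, hδ⟩)
  · exact absurd (RootPairing.Base.IsPos.add hβ hγ h) hδ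

theorem isClosed_neg (S : Set b.support) : IsClosedRoots (rootsOf b S ∪ negRoots b) := by
  intro β hβ γ hγ δ h
  by_cases hδ : ¬ b.IsPos δ
  · exact Or.inr hδ
  left
  rw [not_not] at hδ
  rcases hβ with hβ | hβ <;> rcases hγ with hγ | hγ
  · exact rootsOf_add b hβ hγ h
  · exact mem_rootsOf_of_add b hβ h (Or.inr ⟨hγ, hδ⟩)
  · exact mem_rootsOf_of_add b hγ (by rw [h, add_comm]) (Or.inr ⟨hβ, hδ⟩)
  · have h1 := b.height_add h
    change ¬ b.IsPos β at hβ
    change ¬ b.IsPos γ at hγ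
    rw [RootPairing.Base.isPos_iff] at hβ hγ hδ
    omega

theorem lie_mem_of_closed {Φ : Set H.root} (hΦ : IsClosedRoots Φ) {x y : g}
    (hx : x ∈ H.toSubmodule ⊔ rootSum Φ) (hy : y ∈ H.toSubmodule ⊔ rootSum Φ) :
    ⁅x, y⁆ ∈ H.toSubmodule ⊔ rootSum Φ := by
  have hroot : ∀ β ∈ Φ, ∀ z ∈ rootSpace H (β : LieModule.Weight k H g), z ∈ rootSum Φ := by
    intro β hβ z hz
    exact Submodule.mem_iSup_of_mem β (Submodule.mem_iSup_of_mem hβ hz)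
  have hHr : ∀ h ∈ H, ∀ z ∈ rootSum Φ, ⁅h, z⁆ ∈ rootSum Φ := by
    intro h hh z hz
    refine Submodule.iSup_induction' (p := fun β : H.root => ⨆ (_ : β ∈ Φ),
      (rootSpace H (β : LieModule.Weight k H g)).toSubmodule)
      (motive := fun z _ => ⁅h, z⁆ ∈ rootSum Φ) ?_ (by simp) ?_ hz
    · intro β z hz
      by_cases hβ : β ∈ Φ
      · simp only [hβ, iSup_pos] at hz
        exact hroot β hβ _ ((rootSpace H (β : LieModule.Weight k H g)).lie_mem (x := ⟨h, hh⟩) hz)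
      · simp only [hβ, not_false_eq_true, iSup_neg, Submodule.mem_bot] at hz
        simp [hz]
    · intro u v _ _ hu hv
      rw [lie_add]
      exact add_mem hu hv
  have hrr : ∀ z ∈ rootSum Φ, ∀ w ∈ rootSum Φ, ⁅z, w⁆ ∈ H.toSubmodule ⊔ rootSum Φ := by
    intro z hz w hw
    refine Submodule.iSup_induction' (p := fun β : H.root => ⨆ (_ : β ∈ Φ),
      (rootSpace H (β : LieModule.Weight k H g)).toSubmodule)
      (motive := fun z _ => ⁅z, w⁆ ∈ H.toSubmodule ⊔ rootSum Φ) ?_ (by simp) ?_ hz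
    · intro β z hz
      by_cases hβ : β ∈ Φ
      swap
      · simp only [hβ, not_false_eq_true, iSup_neg, Submodule.mem_bot] at hz
        simp [hz]
      simp only [hβ, iSup_pos] at hz
      refine Submodule.iSup_induction' (p := fun β : H.root => ⨆ (_ : β ∈ Φ),
        (rootSpace H (β : LieModule.Weight k H g)).toSubmodule)
        (motive := fun w _ => ⁅z, w⁆ ∈ H.toSubmodule ⊔ rootSum Φ) ?_ (by simp) ?_ hw
      · intro γ w hw
        by_cases hγ : γ ∈ Φ
        swap
        · simp only [hγ, not_false_eq_true, iSup_neg, Submodule.mem_bot] at hw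
          simp [hw]
        simp only [hγ, iSup_pos] at hw
        have key : ⁅z, w⁆ ∈ rootSpace H
            ((β : LieModule.Weight k H g) + (γ : LieModule.Weight k H g) : H → k) :=
          lie_mem_genWeightSpace_of_mem_genWeightSpace hz hw
        by_cases h0 : (β : LieModule.Weight k H g) + (γ : LieModule.Weight k H g) = (0 : H → k)
        · rw [h0, rootSpace_zero_eq] at key
          exact Submodule.mem_sup_left key
        by_cases hb : rootSpace H ((β : LieModule.Weight k H g) + (γ : LieModule.Weight k H g) :
            H → k) = ⊥
        · rw [hb, LieSubmodule.mem_bot] at key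
          simp [key]
        let w' : LieModule.Weight k H g := ⟨_, hb⟩
        have hw' : w'.IsNonZero := fun e => h0 e
        let δ : H.root := ⟨w', by simpa using hw'⟩
        have hδ : δ ∈ Φ := hΦ β hβ γ hγ δ (by ext x; rfl)
        exact Submodule.mem_sup_right (hroot δ hδ _ key)
      · intro u v _ _ hu hv
        rw [lie_add]
        exact add_mem hu hv
    · intro u v _ _ hu hv
      rw [add_lie]
      exact add_mem hu hv
  obtain ⟨h, hh, r, hr, rfl⟩ := Submodule.mem_sup.1 hx
  obtain ⟨h', hh', r', hr', rfl⟩ := Submodule.mem_sup.1 hy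
  rw [add_lie, lie_add, lie_add]
  refine add_mem (add_mem ?_ ?_) (add_mem ?_ ?_)
  · exact Submodule.mem_sup_left (H.lie_mem hh hh')
  · exact Submodule.mem_sup_right (hHr h hh r' hr')
  · rw [← lie_skew]
    exact neg_mem (Submodule.mem_sup_right (hHr h' hh' r hr))
  · exact hrr r hr r' hr'

/-! ### The standard parabolic subalgebras and seaweeds -/

/-- `p_S⁺`, the sum of `h` and of the root spaces `g_β`, `β ∈ R_S ∪ R⁺`. -/
def parabolicPos (S : Set b.support) : LieSubalgebra k g where
  __ := H.toSubmodule ⊔ rootSum (rootsOf b S ∪ posRoots b)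
  lie_mem' := lie_mem_of_closed (isClosed_pos b S)

/-- `p_S⁻`, the sum of `h` and of the root spaces `g_β`, `β ∈ R_S ∪ R⁻`. -/
def parabolicNeg (S : Set b.support) : LieSubalgebra k g where
  __ := H.toSubmodule ⊔ rootSum (rootsOf b S ∪ negRoots b)
  lie_mem' := lie_mem_of_closed (isClosed_neg b S)

/-- The standard seaweed `q_{S,T} = p_S⁻ ∩ p_T⁺`. -/
def seaweed (S T : Set b.support) : LieSubalgebra k g :=
  parabolicNeg b S ⊓ parabolicPos b T

/-- `l_{S,T}`, the sum of `h` and of the root spaces `g_β`, `β ∈ R_{S ∩ T}`. -/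
def levi (S T : Set b.support) : Submodule k g :=
  H.toSubmodule ⊔ rootSum (rootsOf b (S ∩ T))

/-- `n⁺_{S,T}`, the sum of the root spaces `g_β` with `β` in `R_S⁺` but not in `R_{S ∩ T}`. -/
def nilPos (S T : Set b.support) : Submodule k g :=
  rootSum ((posRoots b ∩ rootsOf b S) \ rootsOf b (S ∩ T))

/-- `n⁻_{S,T}`, the sum of the root spaces `g_β` with `β` in `R_T⁻` but not in `R_{S ∩ T}`. -/
def nilNeg (S T : Set b.support) : Submodule k g :=
  rootSum ((negRoots b ∩ rootsOf b T) \ rootsOf b (S ∩ T))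

/-- The nilpotent radical `n_{S,T} = n⁺_{S,T} ⊕ n⁻_{S,T}` of `q_{S,T}`. -/
def nilradical (S T : Set b.support) : Submodule k g :=
  nilPos b S T ⊔ nilNeg b S T

/-- The parabolic part `p⁺_{S,T} = l_{S,T} ⊕ n⁺_{S,T}` of `q_{S,T}`, a parabolic subalgebra of the
reductive Lie algebra `q_{S,S}`, with nilpotent radical `n⁺_{S,T}`. -/
def parabolicPart (S T : Set b.support) : Submodule k g :=
  levi b S T ⊔ nilPos b S T

/-- The centralizer `q^x = {z ∈ q | [x, z] = 0}` of `x` in `q`. -/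
def centralizerIn (q : Submodule k g) (x : g) : Submodule k g :=
  q ⊓ LinearMap.ker (LieAlgebra.ad k g x : g →ₗ[k] g)

end Standard

end Seaweed
end

/-! Weights are written in coordinates with respect to the simple roots, counted from 0: `v 3`, `v
4`, `v 7` are the coefficients of α₄, α₅, α₈. The parabolic part is graded by the pair (`v 3`, `v
4`). Its degree (0,0) piece is the Levi part, of dimension 22, and n⁺ splits into the degrees (1,0),
(0,1), (1,1), the last of dimension at least 18, and the span of the higher degrees, here called
"high".

Let x be a Richardson element of the parabolic part p⁺, with components u, v, w in degrees (1,0),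
(0,1), (1,1) and f in high. Let K be the space of z in p⁺ with [x,z] in high. Since [x,p⁺] = n⁺,
rank-nullity gives dim K ≤ 22 + dim high. On the other hand K ∩ n⁺ contains the degree (1,1) piece,
high, and the extra vector u + v, so its dimension is at least 19 + dim high. Hence the Levi
components of elements of K form a space of dimension at most 3.

Three independent Levi components can be written down. One is the coweight h dual to α₈, which
commutes with x. The others are the brackets [v,y], where y has degree (0,-1) and [v,[v,y]] = 0. The
map y ↦ [v,[v,y]] sends a space of dimension at least 3 into the line through v (`exists_trace`), so
these y fill a space of dimension at least 2. The same lemma shows that [v,y] kills u, and [v,y] -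
[w,y] then lies in K. So the Levi component of every element of K, in particular of every element of
p⁺ that commutes with x, is a combination of h and such brackets (`inf_comap_le`).

Now let m be in n⁻. The coweight h sends m to a multiple of m. Since n⁺ and n⁻ commute, [m,[v,y]] =
[v,[m,y]], and [m,y] lies in the root space of -(α₅+α₆+α₇+α₈), which is a line. Therefore [m,q^x]
lies in the sum of two spaces of dimension at most 1 (`finrank_map_centralizerIn_le`). If q had a
Richardson element u + m, then u would be Richardson in p⁺ and [m,q^u] would be all of n⁻, which has
dimension 3 (`not_isRichardson`).

The existence of a Richardson element of p⁺ is a separate matter: a sum of seven root vectors works,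
by a finite computation with roots (`exists_isRichardson`). All statements about particular roots
are checked on an explicit list of the positive roots of E₈. -/

noncomputable section

namespace Seaweed

variable {k g : Type*} [Field k] [CharZero k] [LieRing g] [LieAlgebra k g] [FiniteDimensional k g]
  [IsKilling k g] {H : LieSubalgebra k g} [H.IsCartanSubalgebra]
  [LieModule.IsTriangularizable k H g]

/-! ### Weight spaces indexed by integer vectors. -/

section Weights

variable (b : (rootSystem H).Base) (α : Fin 8 ≃ b.support)

/-- The linear functional `∑ vᵢ αᵢ` on the Cartan subalgebra. -/
def weightVec (v : Fin 8 → ℤ) : Dual k H :=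
  ∑ i, v i • (rootSystem H).root (α i)

/-- The weight space of weight `∑ vᵢ αᵢ`. -/
def wtSpace (v : Fin 8 → ℤ) : Submodule k g :=
  (rootSpace H (weightVec b α v : H → k)).toSubmodule

/-- The sum of the weight spaces with weights in `A`. -/
def wtSum (A : Set (Fin 8 → ℤ)) : Submodule k g := ⨆ v ∈ A, wtSpace b α v

/-- `v` is the coordinate vector of a root. -/
def IsRootVec (v : Fin 8 → ℤ) : Prop := ∃ β : H.root, (rootSystem H).root β = weightVec b α v

@[simp] theorem weightVec_zero : weightVec b α 0 = 0 := by simp [weightVec]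

theorem weightVec_add (v w : Fin 8 → ℤ) :
    weightVec b α (v + w) = weightVec b α v + weightVec b α w := by
  simp [weightVec, add_smul, Finset.sum_add_distrib]

theorem weightVec_neg (v : Fin 8 → ℤ) : weightVec b α (-v) = -weightVec b α v := by
  simp [weightVec]

theorem weightVec_sub (v w : Fin 8 → ℤ) :
    weightVec b α (v - w) = weightVec b α v - weightVec b α w := by
  rw [sub_eq_add_neg, weightVec_add, weightVec_neg, ← sub_eq_add_neg]

theorem weightVec_smul (n : ℤ) (v : Fin 8 → ℤ) :
    weightVec b α (n • v) = n • weightVec b α v := by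
  simp [weightVec, Finset.smul_sum, mul_smul]

theorem weightVec_single (i : Fin 8) :
    weightVec b α (Pi.single i 1) = (rootSystem H).root (α i) := by
  rw [weightVec, Finset.sum_eq_single i]
  · simp
  · intro j _ hj; simp [Pi.single_eq_of_ne hj]
  · simp

theorem weightVec_repr (v : Fin 8 → ℤ) (i : Fin 8) :
    b.toWeightBasis.repr (weightVec b α v) (α i) = (v i : k) := by
  have : weightVec b α v = ∑ j : b.support, (v (α.symm j) : k) • b.toWeightBasis j := by
    rw [weightVec, ← α.sum_comp]
    refine Finset.sum_congr rfl fun j _ => ?_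
    rw [RootPairing.Base.toWeightBasis_apply, α.symm_apply_apply]
    exact (Int.cast_smul_eq_zsmul k _ _).symm
  rw [this, b.toWeightBasis.repr_sum_self, α.symm_apply_apply]

theorem weightVec_injective : Function.Injective (weightVec b α) := by
  intro v w h
  ext i
  have := weightVec_repr b α v i
  rw [h, weightVec_repr] at this
  exact_mod_cast this.symm

theorem exists_coords (β : H.root) : ∃ v : Fin 8 → ℤ, (rootSystem H).root β = weightVec b α v ∧
    (b.IsPos β → ∀ i, 0 ≤ v i) ∧ (¬ b.IsPos β → ∀ i, v i ≤ 0) := by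
  obtain ⟨f, hf, h1, h2⟩ := exists_coeff b β
  refine ⟨fun i => f (α i), ?_, fun h i => h1 h _, fun h i => h2 h _⟩
  rw [hf, weightVec, ← b.support.sum_coe_sort]
  exact (α.sum_comp (fun j : b.support => f j • (rootSystem H).root j)).symm

theorem height_eq {β : H.root} {v : Fin 8 → ℤ} (h : (rootSystem H).root β = weightVec b α v) :
    b.height β = ∑ i, v i := by
  obtain ⟨f, hf, -, -⟩ := exists_coeff b β
  have : v = fun i => f (α i) := by
    refine weightVec_injective b α (h.symm.trans ?_)
    rw [hf, weightVec, ← b.support.sum_coe_sort]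
    exact (α.sum_comp (fun j : b.support => f j • (rootSystem H).root j)).symm
  rw [b.height_eq_sum hf, this, ← b.support.sum_coe_sort]
  exact (α.sum_comp (fun j : b.support => f j)).symm

theorem wtSpace_root {β : H.root} {v : Fin 8 → ℤ} (h : (rootSystem H).root β = weightVec b α v) :
    wtSpace b α v = (rootSpace H (β : LieModule.Weight k H g)).toSubmodule := by
  rw [wtSpace, ← h]; rfl

theorem wtSpace_zero : wtSpace b α 0 = H.toSubmodule := by
  rw [wtSpace, weightVec_zero]
  exact congrArg LieSubmodule.toSubmodule (rootSpace_zero_eq k g H)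

theorem isRootVec_iff {v : Fin 8 → ℤ} : IsRootVec b α v ↔ v ≠ 0 ∧ wtSpace b α v ≠ ⊥ := by
  constructor
  · rintro ⟨β, hβ⟩
    refine ⟨?_, ?_⟩
    · rintro rfl
      rw [weightVec_zero] at hβ
      exact (rootSystem H).ne_zero β hβ
    · rw [wtSpace_root b α hβ, ne_eq, LieSubmodule.toSubmodule_eq_bot]
      exact (β : LieModule.Weight k H g).genWeightSpace_ne_bot
  · rintro ⟨h0, hv⟩
    rw [wtSpace, ne_eq, LieSubmodule.toSubmodule_eq_bot] at hv
    let w : LieModule.Weight k H g := ⟨_, hv⟩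
    have hw : w.IsNonZero := fun e => h0 (weightVec_injective b α (by
      rw [weightVec_zero]; ext x; exact congrFun e x))
    exact ⟨⟨w, by simpa using hw⟩, by ext x; rfl⟩

theorem finrank_wtSpace {v : Fin 8 → ℤ} (h : IsRootVec b α v) : finrank k (wtSpace b α v) = 1 := by
  obtain ⟨β, hβ⟩ := h
  rw [wtSpace_root b α hβ]
  exact finrank_rootSpace_eq_one _ (LieSubalgebra.isNonZero_coe_root β)

theorem wtSpace_eq_bot {v : Fin 8 → ℤ} (h0 : v ≠ 0) (h : ¬ IsRootVec b α v) :
    wtSpace b α v = ⊥ := by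
  by_contra h'
  exact h ((isRootVec_iff b α).2 ⟨h0, h'⟩)

theorem lie_mem_wtSpace {v w : Fin 8 → ℤ} {x y : g} (hx : x ∈ wtSpace b α v)
    (hy : y ∈ wtSpace b α w) : ⁅x, y⁆ ∈ wtSpace b α (v + w) := by
  have := lie_mem_genWeightSpace_of_mem_genWeightSpace (H := H) hx hy
  rw [wtSpace, weightVec_add]
  exact this

theorem lie_cartan {v : Fin 8 → ℤ} {x : g} (hx : x ∈ wtSpace b α v) (h : H) :
    ⁅(h : g), x⁆ = weightVec b α v h • x := by
  exact lie_eq_smul_of_mem_rootSpace (H := H) hx h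

theorem iSupIndep_wtSpace : iSupIndep (wtSpace b α) := by
  have h := (LieSubmodule.iSupIndep_toSubmodule.2 (LieModule.iSupIndep_genWeightSpace k H g))
  refine h.comp (f := fun v => (weightVec b α v : H → k)) fun v w e => ?_
  exact weightVec_injective b α (DFunLike.coe_injective e)

theorem iSup_wtSpace : ⨆ v, wtSpace b α v = ⊤ := by
  rw [eq_top_iff]
  have h := LieModule.iSup_genWeightSpace_eq_top' k H g
  rw [← LieSubmodule.toSubmodule_inj, LieSubmodule.iSup_toSubmodule] at h
  rw [LieSubmodule.top_toSubmodule] at h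
  rw [← h, iSup_le_iff]
  intro χ
  by_cases hχ : χ.IsZero
  · refine le_trans (le_of_eq ?_) (le_iSup _ (0 : Fin 8 → ℤ))
    rw [wtSpace, weightVec_zero, hχ.eq]; rfl
  · obtain ⟨v, hv, -⟩ := exists_coords b α (⟨χ, by simpa using hχ⟩ : H.root)
    exact le_trans (le_of_eq (wtSpace_root b α hv).symm) (le_iSup _ v)

theorem mem_wtSum {A : Set (Fin 8 → ℤ)} {v : Fin 8 → ℤ} (hv : v ∈ A) {x : g}
    (hx : x ∈ wtSpace b α v) : x ∈ wtSum b α A :=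
  Submodule.mem_iSup_of_mem v (Submodule.mem_iSup_of_mem hv hx)

theorem wtSpace_le_wtSum {A : Set (Fin 8 → ℤ)} {v : Fin 8 → ℤ} (hv : v ∈ A) :
    wtSpace b α v ≤ wtSum b α A := fun _ => mem_wtSum b α hv

/-- The weight space of a nonzero vector that is not a root vanishes. This is why the lemmas on
`wtSum` carry the side condition `v = 0 ∨ IsRootVec b α v`, which later allows checks on the finite
list of roots. -/
theorem wtSum_le {A : Set (Fin 8 → ℤ)} {W : Submodule k g}
    (h : ∀ v ∈ A, (v = 0 ∨ IsRootVec b α v) → wtSpace b α v ≤ W) : wtSum b α A ≤ W := by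
  refine iSup₂_le fun v hv => ?_
  by_cases h0 : v = 0 ∨ IsRootVec b α v
  · exact h v hv h0
  · rw [not_or] at h0
    rw [wtSpace_eq_bot b α h0.1 h0.2]; exact bot_le

theorem wtSum_mono {A B : Set (Fin 8 → ℤ)}
    (h : ∀ v ∈ A, (v = 0 ∨ IsRootVec b α v) → v ∈ B) : wtSum b α A ≤ wtSum b α B :=
  wtSum_le b α fun v hv h0 => wtSpace_le_wtSum b α (h v hv h0)

theorem wtSum_congr {A B : Set (Fin 8 → ℤ)}
    (h : ∀ v, (v = 0 ∨ IsRootVec b α v) → (v ∈ A ↔ v ∈ B)) : wtSum b α A = wtSum b α B :=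
  le_antisymm (wtSum_mono b α fun v hv h0 => (h v h0).1 hv)
    (wtSum_mono b α fun v hv h0 => (h v h0).2 hv)

theorem wtSum_union (A B : Set (Fin 8 → ℤ)) :
    wtSum b α (A ∪ B) = wtSum b α A ⊔ wtSum b α B := iSup_union

theorem wtSum_singleton (v : Fin 8 → ℤ) : wtSum b α {v} = wtSpace b α v := by simp [wtSum]

theorem wtSum_univ : wtSum b α Set.univ = ⊤ := by
  rw [wtSum, ← iSup_wtSpace b α]; simp

theorem wtSum_disjoint {A B : Set (Fin 8 → ℤ)} (h : Disjoint A B) :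
    Disjoint (wtSum b α A) (wtSum b α B) :=
  (iSupIndep_wtSpace b α).disjoint_biSup_biSup h

/-- Split `A` into `A ∩ B` and `A \ B`; the second part is independent of `B`, and the modular law
concludes. -/
theorem wtSum_inter (A B : Set (Fin 8 → ℤ)) :
    wtSum b α (A ∩ B) = wtSum b α A ⊓ wtSum b α B := by
  have h1 : wtSum b α A = wtSum b α (A ∩ B) ⊔ wtSum b α (A \ B) := by
    rw [← wtSum_union, Set.inter_union_sdiff]
  have h2 : wtSum b α (A ∩ B) ≤ wtSum b α B := wtSum_mono b α fun v hv _ => hv.2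
  rw [h1, sup_inf_assoc_of_le _ h2,
    (wtSum_disjoint b α Set.disjoint_sdiff_left).eq_bot, sup_bot_eq]

/-- The pair of zero weights may be left out because the Cartan subalgebra is abelian. This
refinement is what makes the derived series of a Borel subalgebra gain height at its first step. -/
theorem lie_mem_wtSum_of_ne_zero {A B C : Set (Fin 8 → ℤ)}
    (h : ∀ v ∈ A, ∀ w ∈ B, (v = 0 ∨ IsRootVec b α v) → (w = 0 ∨ IsRootVec b α w) →
      (v + w = 0 ∨ IsRootVec b α (v + w)) → ¬ (v = 0 ∧ w = 0) → v + w ∈ C) {x y : g}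
    (hx : x ∈ wtSum b α A) (hy : y ∈ wtSum b α B) : ⁅x, y⁆ ∈ wtSum b α C := by
  have h1 : wtSum b α A ≤ (wtSum b α C).comap (LieAlgebra.ad k g y : g →ₗ[k] g) := by
    refine wtSum_le b α fun v hv hv0 x hx => ?_
    have h2 : wtSum b α B ≤ (wtSum b α C).comap (LieAlgebra.ad k g x : g →ₗ[k] g) := by
      refine wtSum_le b α fun w hw hw0 y hy => ?_
      change ⁅x, y⁆ ∈ wtSum b α C
      by_cases hvw : v = 0 ∧ w = 0
      · obtain ⟨rfl, rfl⟩ := hvw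
        rw [wtSpace_zero] at hx hy
        have : ⁅(⟨x, hx⟩ : H), (⟨y, hy⟩ : H)⁆ = 0 := trivial_lie_zero _ _ _ _
        have : ⁅x, y⁆ = 0 := congrArg Subtype.val this
        rw [this]; exact zero_mem _
      have h3 := lie_mem_wtSpace b α hx hy
      by_cases h0 : v + w = 0 ∨ IsRootVec b α (v + w)
      · exact mem_wtSum b α (h v hv w hw hv0 hw0 h0 hvw) h3
      · rw [not_or] at h0
        rw [wtSpace_eq_bot b α h0.1 h0.2, Submodule.mem_bot] at h3
        rw [h3]; exact zero_mem _
    change ⁅y, x⁆ ∈ wtSum b α C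
    rw [← lie_skew]
    exact neg_mem (h2 hy)
  rw [← lie_skew]
  exact neg_mem (h1 hx)

theorem lie_mem_wtSum {A B C : Set (Fin 8 → ℤ)}
    (h : ∀ v ∈ A, ∀ w ∈ B, (v = 0 ∨ IsRootVec b α v) → (w = 0 ∨ IsRootVec b α w) →
      (v + w = 0 ∨ IsRootVec b α (v + w)) → v + w ∈ C) {x y : g} (hx : x ∈ wtSum b α A)
    (hy : y ∈ wtSum b α B) : ⁅x, y⁆ ∈ wtSum b α C :=
  lie_mem_wtSum_of_ne_zero b α (fun v hv w hw h1 h2 h3 _ => h v hv w hw h1 h2 h3) hx hy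

theorem lie_eq_zero_of_wtSum {A B : Set (Fin 8 → ℤ)}
    (h : ∀ v ∈ A, ∀ w ∈ B, (v = 0 ∨ IsRootVec b α v) → (w = 0 ∨ IsRootVec b α w) →
      ¬ (v + w = 0 ∨ IsRootVec b α (v + w))) {x y : g} (hx : x ∈ wtSum b α A)
    (hy : y ∈ wtSum b α B) : ⁅x, y⁆ = 0 := by
  have := lie_mem_wtSum b α (C := ∅) (fun v hv w hw h1 h2 h3 => (h v hv w hw h1 h2 h3).elim) hx hy
  simpa [wtSum] using this

end Weights

end Seaweed

/-! ### The E₈ form and the pairing of roots. -/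

namespace Seaweed

/-- The bilinear form on `ℤ⁸` given by the Cartan matrix of type `E₈`. -/
def form (v w : Fin 8 → ℤ) : ℤ := v ⬝ᵥ (CartanMatrix.E₈.mulVec w)

theorem form_add_left (u v w : Fin 8 → ℤ) : form (u + v) w = form u w + form v w := by
  simp [form, add_dotProduct]

theorem form_add_right (u v w : Fin 8 → ℤ) : form u (v + w) = form u v + form u w := by
  simp [form, Matrix.mulVec_add, dotProduct_add]

theorem form_sub_left (u v w : Fin 8 → ℤ) : form (u - v) w = form u w - form v w := by
  simp [form, sub_dotProduct]

theorem form_sub_right (u v w : Fin 8 → ℤ) : form u (v - w) = form u v - form u w := by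
  simp [form, Matrix.mulVec_sub, dotProduct_sub]

theorem form_neg_left (v w : Fin 8 → ℤ) : form (-v) w = -form v w := by
  simp [form]

theorem form_neg_right (v w : Fin 8 → ℤ) : form v (-w) = -form v w := by
  simp [form, Matrix.mulVec_neg]

theorem form_smul_left (n : ℤ) (v w : Fin 8 → ℤ) : form (n • v) w = n * form v w := by
  rw [form, smul_dotProduct, smul_eq_mul, form]

theorem form_smul_right (n : ℤ) (v w : Fin 8 → ℤ) : form v (n • w) = n * form v w := by
  rw [form, Matrix.mulVec_smul, dotProduct_smul, smul_eq_mul, form]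

theorem form_comm (v w : Fin 8 → ℤ) : form v w = form w v := by
  rw [form, form, Matrix.dotProduct_mulVec, ← Matrix.mulVec_transpose,
    CartanMatrix.E₈_transpose, dotProduct_comm]

theorem form_single_right (v : Fin 8 → ℤ) (i : Fin 8) :
    form v (Pi.single i 1) = ∑ j, v j * CartanMatrix.E₈ j i := by
  simp [form, dotProduct]

theorem form_single_self (i : Fin 8) : form (Pi.single i 1) (Pi.single i 1) = 2 := by
  rw [form_single_right, Finset.sum_eq_single i]
  · rw [Pi.single_eq_same]; fin_cases i <;> rfl
  · intro j _ hj; simp [Pi.single_eq_of_ne hj]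
  · simp

variable {k g : Type*} [Field k] [CharZero k] [LieRing g] [LieAlgebra k g] [FiniteDimensional k g]
  [IsKilling k g] {H : LieSubalgebra k g} [H.IsCartanSubalgebra]
  [LieModule.IsTriangularizable k H g]

section RootsE8

variable (b : (rootSystem H).Base) (α : Fin 8 ≃ b.support)
  (hE : ∀ i j : Fin 8, b.cartanMatrix (α i) (α j) = CartanMatrix.E₈ i j)

include hE

theorem pairing_simple {β : H.root} {v : Fin 8 → ℤ}
    (hv : (rootSystem H).root β = weightVec b α v) (i : Fin 8) :
    (rootSystem H).pairingIn ℤ β (α i) = form v (Pi.single i 1) := by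
  have h : (algebraMap ℤ k) ((rootSystem H).pairingIn ℤ β (α i))
      = algebraMap ℤ k (form v (Pi.single i 1)) := by
    rw [RootPairing.algebraMap_pairingIn, ← RootPairing.root_coroot'_eq_pairing, hv, weightVec,
      map_sum, form_single_right, map_sum]
    refine Finset.sum_congr rfl fun j _ => ?_
    rw [map_zsmul, RootPairing.root_coroot'_eq_pairing, ← hE j i,
      RootPairing.Base.cartanMatrix, RootPairing.Base.cartanMatrixIn_def, map_mul,
      RootPairing.algebraMap_pairingIn, zsmul_eq_mul]
    rfl
  exact_mod_cast h

theorem root_reflect {β : H.root} {v : Fin 8 → ℤ}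
    (hv : (rootSystem H).root β = weightVec b α v) (i : Fin 8) :
    (rootSystem H).root ((rootSystem H).reflectionPerm (α i) β) =
      weightVec b α (v - form v (Pi.single i 1) • Pi.single i 1) := by
  rw [RootPairing.root_reflectionPerm, RootPairing.reflection_apply_root' ℤ,
    pairing_simple b α hE hv, hv, weightVec_sub, weightVec_smul, weightVec_single]

/-- Every root is reached from a simple root by simple reflections and negation, and both sides are
invariant under reflecting both arguments. -/
theorem pairing_eq {β γ : H.root} {v w : Fin 8 → ℤ}
    (hv : (rootSystem H).root β = weightVec b α v)
    (hw : (rootSystem H).root γ = weightVec b α w) :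
    (rootSystem H).pairingIn ℤ β γ = form v w := by
  -- A reflection moves both roots, so the induction on `γ` needs a statement about all `β`.
  revert β v w
  refine b.induction_reflect γ (p := fun γ => ∀ {β : H.root} {v w : Fin 8 → ℤ},
    (rootSystem H).root β = weightVec b α v → (rootSystem H).root γ = weightVec b α w →
    (rootSystem H).pairingIn ℤ β γ = form v w) ?_ ?_ ?_
  · intro γ ih β v w hv hw
    rw [RootPairing.pairingIn_reflectionPerm_self_right, ih (w := -w) hv, form_neg_right, neg_neg]
    rw [weightVec_neg, ← hw, RootPairing.root_reflectionPerm, RootPairing.reflection_apply_self,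
      neg_neg]
  · intro γ hγ β v w hv hw
    obtain ⟨i, hi⟩ := α.surjective ⟨γ, hγ⟩
    have hi' : (α i : H.root) = γ := by rw [hi]
    subst hi'
    rw [← weightVec_single] at hw
    rw [← weightVec_injective b α hw]
    exact pairing_simple b α hE hv i
  · intro γ j ih hj β v w hv hw
    obtain ⟨i, hi⟩ := α.surjective ⟨j, hj⟩
    have hi' : (α i : H.root) = j := by rw [hi]
    subst hi'
    have h1 := root_reflect b α hE hv i
    have h2 := root_reflect b α hE hw i
    rw [RootPairing.reflectionPerm_self] at h2
    rw [RootPairing.pairingIn_reflectionPerm, ih h1 h2]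
    simp only [form_sub_left, form_sub_right, form_smul_left, form_smul_right, form_single_self]
    rw [form_comm (Pi.single i 1) w]
    ring

theorem form_self {v : Fin 8 → ℤ} (hv : IsRootVec b α v) : form v v = 2 := by
  obtain ⟨β, hβ⟩ := hv
  rw [← pairing_eq b α hE hβ hβ, RootPairing.pairingIn_same]

theorem IsRootVec.reflect {v w : Fin 8 → ℤ} (hv : IsRootVec b α v) (hw : IsRootVec b α w) :
    IsRootVec b α (v - form v w • w) := by
  obtain ⟨β, hβ⟩ := hv
  obtain ⟨γ, hγ⟩ := hw
  refine ⟨(rootSystem H).reflectionPerm γ β, ?_⟩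
  rw [RootPairing.root_reflectionPerm, RootPairing.reflection_apply_root' ℤ,
    pairing_eq b α hE hβ hγ, hβ, hγ, weightVec_sub, weightVec_smul]

omit hE in
theorem isRootVec_single (i : Fin 8) : IsRootVec b α (Pi.single i 1) :=
  ⟨α i, (weightVec_single b α i).symm⟩

theorem IsRootVec.neg {v : Fin 8 → ℤ} (hv : IsRootVec b α v) : IsRootVec b α (-v) := by
  have := hv.reflect b α hE hv
  rw [form_self b α hE hv] at this
  convert this using 1
  ext i; simp; ring

end RootsE8

end Seaweed

/-! ### The explicit list of roots of E₈. -/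

namespace Seaweed

/-- The vector whose coordinates are the eight decimal digits of `n`. -/
def codeVec (n : ℕ) : Fin 8 → ℤ := fun i => ((n / 10 ^ (7 - (i : ℕ)) % 10 : ℕ) : ℤ)

/-- The positive roots of `E₈`: the digits of a code are the coordinates with respect to the simple
roots. -/
def posCodes : List ℕ :=
  [1, 10, 11, 100, 110, 111, 1000, 1100, 1110, 1111, 10000, 11000, 11100, 11110, 11111, 100000,
   110000, 111000, 111100, 111110, 111111, 1000000, 1010000, 1011000, 1011100, 1011110, 1011111,
   1110000, 1111000, 1111100, 1111110, 1111111, 1121000, 1121100, 1121110, 1121111, 1122100,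
   1122110, 1122111, 1122210, 1122211, 1122221, 10000000, 10100000, 10110000, 10111000,
   10111100, 10111110, 10111111, 11110000, 11111000, 11111100, 11111110, 11111111, 11121000,
   11121100, 11121110, 11121111, 11122100, 11122110, 11122111, 11122210, 11122211, 11122221,
   11221000, 11221100, 11221110, 11221111, 11222100, 11222110, 11222111, 11222210, 11222211,
   11222221, 11232100, 11232110, 11232111, 11232210, 11232211, 11232221, 11233210, 11233211,
   11233221, 11233321, 12232100, 12232110, 12232111, 12232210, 12232211, 12232221, 12233210,
   12233211, 12233221, 12233321, 12243210, 12243211, 12243221, 12243321, 12244321, 12343210,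
   12343211, 12343221, 12343321, 12344321, 12354321, 13354321, 22343210, 22343211, 22343221,
   22343321, 22344321, 22354321, 22454321, 23354321, 23454321, 23464321, 23465321, 23465421,
   23465431, 23465432]

/-- The pairing of the vector with code `n` and the `i`-th simple root. -/
def codePairing (n : ℕ) (i : Fin 8) : ℤ :=
  let c := codeVec n
  ![2 * c 0 - c 2, 2 * c 1 - c 3, 2 * c 2 - c 0 - c 3, 2 * c 3 - c 1 - c 2 - c 4,
    2 * c 4 - c 3 - c 5, 2 * c 5 - c 4 - c 6, 2 * c 6 - c 5 - c 7, 2 * c 7 - c 6] i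

theorem form_codeVec_single (n : ℕ) (i : Fin 8) :
    form (codeVec n) (Pi.single i 1) = codePairing n i := by
  rw [form_single_right, Fin.sum_univ_eight, codePairing]
  generalize codeVec n = c
  fin_cases i <;> simp [CartanMatrix.E₈] <;> ring

/-- The code of the reflection of the vector with code `n` in the `i`-th simple root. -/
def codeReflect (n : ℕ) (i : Fin 8) : ℕ := (n - codePairing n i * 10 ^ (7 - (i : ℕ)) : ℤ).toNat

theorem codeVec_simple : ∀ i : Fin 8, codeVec (10 ^ (7 - (i : ℕ))) = Pi.single i 1 := by
  decide

theorem simple_mem_posCodes : ∀ i : Fin 8, 10 ^ (7 - (i : ℕ)) ∈ posCodes := by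
  decide +kernel

/-- A simple reflection permutes the positive roots other than its own simple root. The digitwise
equation certifies that the decimal subtraction has no carry, borrow or truncation. -/
theorem codeReflect_mem : ∀ n ∈ posCodes, ∀ i : Fin 8, n = 10 ^ (7 - (i : ℕ)) ∨
    (codeReflect n i ∈ posCodes ∧ ∀ j : Fin 8, codeVec (codeReflect n i) j =
      codeVec n j - if j = i then codePairing n i else 0) := by
  decide +kernel

theorem exists_codeReflect_lt : ∀ n ∈ posCodes, ∃ i : Fin 8, n = 10 ^ (7 - (i : ℕ)) ∨
    codeReflect n i < n := by
  decide +kernel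

theorem codeVec_codeReflect {n : ℕ} {i : Fin 8} (h : ∀ j : Fin 8, codeVec (codeReflect n i) j =
      codeVec n j - if j = i then codePairing n i else 0) :
    codeVec (codeReflect n i) =
      codeVec n - form (codeVec n) (Pi.single i 1) • Pi.single i 1 := by
  ext j
  rw [h, form_codeVec_single, Pi.sub_apply, Pi.smul_apply, Pi.single_apply]
  split_ifs <;> simp

variable {k g : Type*} [Field k] [CharZero k] [LieRing g] [LieAlgebra k g] [FiniteDimensional k g]
  [IsKilling k g] {H : LieSubalgebra k g} [H.IsCartanSubalgebra]
  [LieModule.IsTriangularizable k H g]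

section RootList

variable (b : (rootSystem H).Base) (α : Fin 8 ≃ b.support)
  (hE : ∀ i j : Fin 8, b.cartanMatrix (α i) (α j) = CartanMatrix.E₈ i j)

include hE

/-- A code that is not simple has a simple reflection with a smaller code. That one is a root by
induction, and reflecting it back gives the original vector. -/
theorem isRootVec_codeVec {n : ℕ} (hn : n ∈ posCodes) : IsRootVec b α (codeVec n) := by
  induction n using Nat.strong_induction_on with
  | _ n ih =>
    obtain ⟨i, hi⟩ := exists_codeReflect_lt n hn
    rcases codeReflect_mem n hn i with h | ⟨h1, h2⟩
    · rw [h, codeVec_simple]; exact isRootVec_single b α i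
    · rcases hi with h | hi
      · rw [h, codeVec_simple]; exact isRootVec_single b α i
      have h3 := (ih _ hi h1).reflect b α hE (isRootVec_single b α i)
      rw [codeVec_codeReflect h2, form_sub_left, form_smul_left, form_single_self] at h3
      convert h3 using 1
      module

/-- The list together with its negatives contains the simple roots and is stable under simple
reflections. The sign is needed because a simple reflection negates its own root. -/
theorem exists_code_of_isPos {β : H.root} (hβ : b.IsPos β) :
    ∃ n ∈ posCodes, (rootSystem H).root β = weightVec b α (codeVec n) ∨
      (rootSystem H).root β = -weightVec b α (codeVec n) := by
  refine hβ.induction_on_reflect (p := fun β => ∃ n ∈ posCodes,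
    (rootSystem H).root β = weightVec b α (codeVec n) ∨
      (rootSystem H).root β = -weightVec b α (codeVec n)) ?_ ?_
  · intro β hβ
    obtain ⟨i, hi⟩ := α.surjective ⟨β, hβ⟩
    refine ⟨10 ^ (7 - (i : ℕ)), ?_, Or.inl ?_⟩
    · exact simple_mem_posCodes i
    · rw [codeVec_simple, weightVec_single, hi]
  · rintro β j ⟨n, hn, h⟩ hj
    obtain ⟨i, hi⟩ := α.surjective ⟨j, hj⟩
    have hi' : (α i : H.root) = j := by rw [hi]
    subst hi'
    rcases codeReflect_mem n hn i with h0 | ⟨h1, h2⟩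
    · refine ⟨n, hn, ?_⟩
      rw [RootPairing.root_reflectionPerm]
      rw [h0, codeVec_simple, weightVec_single] at h ⊢
      rcases h with h | h
      · right; rw [h, RootPairing.reflection_apply_self]
      · left; rw [h, map_neg, RootPairing.reflection_apply_self, neg_neg]
    · refine ⟨_, h1, ?_⟩
      rw [codeVec_codeReflect h2]
      rcases h with h | h
      · exact Or.inl (root_reflect b α hE h i)
      · right
        rw [← weightVec_neg] at h ⊢
        rw [root_reflect b α hE h i, form_neg_left]
        congr 1
        module

theorem isRootVec_iff_code {v : Fin 8 → ℤ} :
    IsRootVec b α v ↔ ∃ n ∈ posCodes, v = codeVec n ∨ v = -codeVec n := by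
  constructor
  · rintro ⟨β, hβ⟩
    have key : ∀ γ : H.root, b.IsPos γ → ∀ w, (rootSystem H).root γ = weightVec b α w →
        ∃ n ∈ posCodes, w = codeVec n ∨ w = -codeVec n := by
      intro γ hγ w hw
      obtain ⟨n, hn, h⟩ := exists_code_of_isPos b α hE hγ
      refine ⟨n, hn, ?_⟩
      rw [hw, ← weightVec_neg] at h
      exact h.imp (fun h => weightVec_injective b α h) (fun h => weightVec_injective b α h)
    by_cases h : b.IsPos β
    · exact key β h v hβ
    · have h' : b.IsPos ((rootSystem H).reflectionPerm β β) := by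
        have := b.height_reflectionPerm_self β
        have := b.height_ne_zero β
        rw [RootPairing.Base.isPos_iff] at h ⊢
        change b.height ((rootSystem H).reflectionPerm β β) = _ at *
        omega
      obtain ⟨n, hn, h2⟩ := key _ h' (-v) (by
        rw [RootPairing.root_reflectionPerm, RootPairing.reflection_apply_self, hβ, weightVec_neg])
      refine ⟨n, hn, h2.symm.imp neg_injective.eq_iff.1 (fun h => by rw [← h, neg_neg])⟩
  · rintro ⟨n, hn, rfl | rfl⟩
    · exact isRootVec_codeVec b α hE hn
    · exact (isRootVec_codeVec b α hE hn).neg b α hE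

/-- Reduces a decidable property of all roots to a kernel computation on the list. -/
theorem IsRootVec.forall {p : (Fin 8 → ℤ) → Prop}
    (h : ∀ n ∈ posCodes, p (codeVec n) ∧ p (-codeVec n)) {v : Fin 8 → ℤ}
    (hv : IsRootVec b α v) : p v := by
  obtain ⟨n, hn, rfl | rfl⟩ := (isRootVec_iff_code b α hE).1 hv
  · exact (h n hn).1
  · exact (h n hn).2

end RootList

end Seaweed

/-! ### Brackets of root vectors. -/

namespace Seaweed

variable {k g : Type*} [Field k] [CharZero k] [LieRing g] [LieAlgebra k g] [FiniteDimensional k g]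
  [IsKilling k g] {H : LieSubalgebra k g} [H.IsCartanSubalgebra]
  [LieModule.IsTriangularizable k H g]

section Brackets

variable (b : (rootSystem H).Base) (α : Fin 8 ≃ b.support)
  (hE : ∀ i j : Fin 8, b.cartanMatrix (α i) (α j) = CartanMatrix.E₈ i j)

theorem exists_smul_eq {v : Fin 8 → ℤ} (hv : IsRootVec b α v) {x y : g}
    (hx : x ∈ wtSpace b α v) (hx0 : x ≠ 0) (hy : y ∈ wtSpace b α v) : ∃ c : k, c • x = y := by
  obtain ⟨c, hc⟩ := (finrank_eq_one_iff_of_nonzero' (⟨x, hx⟩ : wtSpace b α v)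
    (by simpa using hx0)).1 (finrank_wtSpace b α hv) ⟨y, hy⟩
  exact ⟨c, congrArg Subtype.val hc⟩

theorem exists_ne_zero {v : Fin 8 → ℤ} (hv : IsRootVec b α v) :
    ∃ x ∈ wtSpace b α v, x ≠ 0 :=
  Submodule.exists_mem_ne_zero_of_ne_bot ((isRootVec_iff b α).1 hv).2

include hE

theorem weightVec_coroot {β : H.root} {v : Fin 8 → ℤ}
    (hv : (rootSystem H).root β = weightVec b α v) (w : Fin 8 → ℤ) :
    weightVec b α w (coroot (β : LieModule.Weight k H g)) = (form w v : k) := by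
  have h : ∀ i, ((rootSystem H).root (α i)) (coroot (β : LieModule.Weight k H g))
      = (form (Pi.single i 1) v : k) := by
    intro i
    rw [← pairing_eq b α hE (weightVec_single b α i).symm hv]
    exact (RootPairing.algebraMap_pairingIn (P := rootSystem H) ℤ (α i) β).symm
  have hw : w = ∑ i, w i • (Pi.single i 1 : Fin 8 → ℤ) := by
    ext j; simp [Finset.sum_apply, Pi.single_apply]
  rw [weightVec, LinearMap.sum_apply]
  simp only [LinearMap.smul_apply, h]
  conv_rhs => rw [form, hw, sum_dotProduct]
  push_cast
  refine Finset.sum_congr rfl fun i _ => ?_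
  rw [smul_dotProduct, form, zsmul_eq_mul, smul_eq_mul]
  push_cast
  rfl

/-- The `sl₂`-triple of a root. -/
theorem IsRootVec.exists_sl2 {v : Fin 8 → ℤ} (hv : IsRootVec b α v) :
    ∃ (t : H) (e f : g), IsSl2Triple (t : g) e f ∧ e ∈ wtSpace b α v ∧ f ∈ wtSpace b α (-v) ∧
      ∀ w, weightVec b α w t = (form w v : k) := by
  obtain ⟨β, hβ⟩ := hv
  have hβ0 := LieSubalgebra.isNonZero_coe_root β
  obtain ⟨h, e, f, ht, he, hf⟩ := exists_isSl2Triple_of_weight_isNonZero hβ0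
  have hh := ht.h_eq_coroot hβ0 he hf
  refine ⟨coroot (β : LieModule.Weight k H g), e, f, hh ▸ ht, ?_, ?_,
    weightVec_coroot b α hE hβ⟩
  · rw [wtSpace_root b α hβ]; exact he
  · rw [wtSpace, weightVec_neg, ← hβ]; exact hf

theorem IsRootVec.exists_coroot {v : Fin 8 → ℤ} (hv : IsRootVec b α v) :
    ∃ t : H, (∀ w, weightVec b α w t = (form w v : k)) ∧
      ∀ x ∈ wtSpace b α v, ∀ y ∈ wtSpace b α (-v), ∃ s : k, ⁅x, y⁆ = s • (t : g) := by
  obtain ⟨t, e, f, ht, he, hf, hw⟩ := hv.exists_sl2 b α hE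
  refine ⟨t, hw, fun x hx y hy => ?_⟩
  obtain ⟨c, rfl⟩ := exists_smul_eq b α hv he ht.e_ne_zero hx
  obtain ⟨d, rfl⟩ := exists_smul_eq b α (hv.neg b α hE) hf ht.f_ne_zero hy
  exact ⟨c * d, by rw [smul_lie, lie_smul, ht.lie_e_f, smul_smul]⟩

theorem form_eq_neg_one {v w : Fin 8 → ℤ} (hv : IsRootVec b α v) (hw : IsRootVec b α w)
    (hvw : IsRootVec b α (v + w)) : form v w = -1 := by
  have h1 := form_self b α hE hv
  have h2 := form_self b α hE hw
  have h3 := form_self b α hE hvw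
  rw [form_add_left, form_add_right, form_add_right, h1, h2, form_comm w v] at h3
  omega

/-- If the bracket vanished, `y` would be a primitive vector of weight -1 for the sl₂-triple of `v`,
whereas the weight of a primitive vector in a finite-dimensional module is a natural number. -/
theorem lie_ne_zero {v w : Fin 8 → ℤ} (hv : IsRootVec b α v) (hw : IsRootVec b α w)
    (hvw : IsRootVec b α (v + w)) {x y : g} (hx : x ∈ wtSpace b α v) (hx0 : x ≠ 0)
    (hy : y ∈ wtSpace b α w) (hy0 : y ≠ 0) : ⁅x, y⁆ ≠ 0 := by
  intro h
  obtain ⟨t, e, f, ht, he, hf, hw'⟩ := hv.exists_sl2 b α hE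
  obtain ⟨c, rfl⟩ := exists_smul_eq b α hv hx hx0 he
  have P : ht.HasPrimitiveVectorWith y (-1 : k) :=
    { ne_zero := hy0
      lie_h := by
        rw [lie_cartan b α hy, hw', form_comm, form_eq_neg_one b α hE hv hw hvw]
        push_cast; rfl
      lie_e := by rw [smul_lie, h, smul_zero] }
  obtain ⟨n, hn⟩ := P.exists_nat
  have : (-1 : ℤ) = n := by exact_mod_cast (show ((-1 : ℤ) : k) = ((n : ℤ) : k) by
    push_cast; exact hn)
  omega

theorem exists_lie_eq {v w : Fin 8 → ℤ} (hv : IsRootVec b α v) (hw : IsRootVec b α w)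
    (hvw : IsRootVec b α (v + w)) {y z : g} (hy : y ∈ wtSpace b α w) (hy0 : y ≠ 0)
    (hz : z ∈ wtSpace b α (v + w)) : ∃ x ∈ wtSpace b α v, ⁅y, x⁆ = z := by
  obtain ⟨x, hx, hx0⟩ := exists_ne_zero b α hv
  have h0 := lie_ne_zero b α hE hv hw hvw hx hx0 hy hy0
  obtain ⟨c, rfl⟩ := exists_smul_eq b α hvw (lie_mem_wtSpace b α hx hy) h0 hz
  exact ⟨-c • x, Submodule.smul_mem _ _ hx, by rw [lie_smul, ← lie_skew, neg_smul, smul_neg,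
    neg_neg]⟩

end Brackets

end Seaweed

/-! ### The subspaces attached to `S` and `T` as sums of weight spaces. -/

namespace Seaweed

/-- The height of a vector: the sum of its coordinates. -/
def ht (v : Fin 8 → ℤ) : ℤ := v 0 + v 1 + v 2 + v 3 + v 4 + v 5 + v 6 + v 7

theorem ht_add (v w : Fin 8 → ℤ) : ht (v + w) = ht v + ht w := by
  simp only [ht, Pi.add_apply]; ring

theorem ht_zero : ht 0 = 0 := by simp [ht]

theorem ht_neg (v : Fin 8 → ℤ) : ht (-v) = -ht v := by
  simp only [ht, Pi.neg_apply]; ring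

/-- The vectors of degree zero with respect to `α₄`, `α₅`, `α₈`. -/
def leviSet : Set (Fin 8 → ℤ) := {v | v 3 = 0 ∧ v 4 = 0 ∧ v 7 = 0}

/-- The weights of the nilradical of the parabolic part. -/
def nilPosSet : Set (Fin 8 → ℤ) := {v | v 7 = 0 ∧ 0 ≤ v 3 ∧ 0 ≤ v 4 ∧ ¬ (v 3 = 0 ∧ v 4 = 0)}

/-- The weights of the parabolic part. -/
def parabolicSet : Set (Fin 8 → ℤ) := {v | v 7 = 0 ∧ 0 ≤ v 3 ∧ 0 ≤ v 4}

/-- The weights of the commuting complement of the parabolic part. -/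
def nilNegSet : Set (Fin 8 → ℤ) := {v | v 3 = 0 ∧ v 4 = 0 ∧ v 7 < 0}

variable {k g : Type*} [Field k] [CharZero k] [LieRing g] [LieAlgebra k g] [FiniteDimensional k g]
  [IsKilling k g] {H : LieSubalgebra k g} [H.IsCartanSubalgebra]
  [LieModule.IsTriangularizable k H g]

section Identification

variable (b : (rootSystem H).Base) (α : Fin 8 ≃ b.support)
  (hE : ∀ i j : Fin 8, b.cartanMatrix (α i) (α j) = CartanMatrix.E₈ i j)

theorem rootSum_eq {Φ : Set H.root} {A : Set (Fin 8 → ℤ)} (h0 : 0 ∉ A)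
    (h : ∀ β v, (rootSystem H).root β = weightVec b α v → (β ∈ Φ ↔ v ∈ A)) :
    rootSum Φ = wtSum b α A := by
  refine le_antisymm (iSup₂_le fun β hβ => ?_) (wtSum_le b α ?_)
  · obtain ⟨v, hv, -⟩ := exists_coords b α β
    rw [← wtSpace_root b α hv]
    exact wtSpace_le_wtSum b α ((h β v hv).1 hβ)
  · rintro v hv (rfl | ⟨β, hβ⟩)
    · exact absurd hv h0
    · rw [wtSpace_root b α hβ]
      exact le_iSup₂_of_le β ((h β v hβ).2 hv) le_rfl

theorem cartan_sup_rootSum_eq {Φ : Set H.root} {A : Set (Fin 8 → ℤ)} (h0 : 0 ∈ A)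
    (h : ∀ β v, (rootSystem H).root β = weightVec b α v → (β ∈ Φ ↔ v ∈ A)) :
    H.toSubmodule ⊔ rootSum Φ = wtSum b α A := by
  have h1 : rootSum Φ = wtSum b α (A \ {0}) := by
    refine rootSum_eq b α (by simp) fun β v hv => ?_
    rw [h β v hv, Set.mem_sdiff, Set.mem_singleton_iff]
    refine ⟨fun h' => ⟨h', ?_⟩, fun h' => h'.1⟩
    rintro rfl
    rw [weightVec_zero] at hv
    exact (rootSystem H).ne_zero β hv
  rw [h1, ← wtSpace_zero b α, ← wtSum_singleton, ← wtSum_union, Set.union_sdiff_self,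
    Set.union_eq_right.2 (Set.singleton_subset_iff.2 h0)]

theorem mem_rootsOf_iff {S : Set b.support} {β : H.root} {v : Fin 8 → ℤ}
    (hv : (rootSystem H).root β = weightVec b α v) :
    β ∈ rootsOf b S ↔ ∀ i, α i ∉ S → v i = 0 := by
  constructor
  · intro h i hi
    have := repr_eq_zero b h (α i) hi
    rw [hv, weightVec_repr] at this
    exact_mod_cast this
  · intro h
    refine mem_rootsOf b fun j hj => ?_
    obtain ⟨i, rfl⟩ := α.surjective j
    rw [hv, weightVec_repr, h i hj, Int.cast_zero]

theorem isPos_iff_ht {β : H.root} {v : Fin 8 → ℤ}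
    (hv : (rootSystem H).root β = weightVec b α v) : b.IsPos β ↔ 0 < ht v := by
  rw [RootPairing.Base.isPos_iff, height_eq b α hv, ht, Fin.sum_univ_eight]

variable {S T : Set b.support} (hS : S = Set.univ \ {α 7}) (hT : T = Set.univ \ {α 3, α 4})

include hS in
theorem forall_notMem_left (v : Fin 8 → ℤ) : (∀ i, α i ∉ S → v i = 0) ↔ v 7 = 0 := by
  rw [hS]
  simp

include hT in
theorem forall_notMem_right (v : Fin 8 → ℤ) :
    (∀ i, α i ∉ T → v i = 0) ↔ v 3 = 0 ∧ v 4 = 0 := by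
  rw [hT]
  constructor
  · intro h
    exact ⟨h 3 (by simp), h 4 (by simp)⟩
  · rintro ⟨h3, h4⟩ i hi
    have : i = 3 ∨ i = 4 := by simpa [or_iff_not_imp_left] using hi
    rcases this with rfl | rfl <;> assumption

include hS in
theorem mem_rootsOf_left {β : H.root} {v : Fin 8 → ℤ}
    (hv : (rootSystem H).root β = weightVec b α v) : β ∈ rootsOf b S ↔ v 7 = 0 := by
  rw [mem_rootsOf_iff b α hv, forall_notMem_left b α hS]

include hT in
theorem mem_rootsOf_right {β : H.root} {v : Fin 8 → ℤ}
    (hv : (rootSystem H).root β = weightVec b α v) : β ∈ rootsOf b T ↔ v 3 = 0 ∧ v 4 = 0 := by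
  rw [mem_rootsOf_iff b α hv, forall_notMem_right b α hT]

include hS hT in
theorem mem_rootsOf_inter {β : H.root} {v : Fin 8 → ℤ}
    (hv : (rootSystem H).root β = weightVec b α v) :
    β ∈ rootsOf b (S ∩ T) ↔ v 3 = 0 ∧ v 4 = 0 ∧ v 7 = 0 := by
  rw [mem_rootsOf_iff b α hv, hS, hT]
  simp only [Set.mem_inter_iff, Set.mem_sdiff, Set.mem_univ, true_and, Set.mem_singleton_iff,
    Set.mem_insert_iff, EmbeddingLike.apply_eq_iff_eq]
  constructor
  · intro h
    exact ⟨h 3 (by decide), h 4 (by decide), h 7 (by decide)⟩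
  · rintro ⟨h3, h4, h7⟩ i hi
    have : i = 7 ∨ i = 3 ∨ i = 4 := by tauto
    rcases this with rfl | rfl | rfl <;> assumption

include hS hT in
theorem levi_eq : levi b S T = wtSum b α leviSet :=
  cartan_sup_rootSum_eq b α (by simp [leviSet]) fun _ _ hv => mem_rootsOf_inter b α hS hT hv

-- The coordinates of a root all have the same sign, so any nonzero one decides positivity. This
-- lemma and the next turn conditions on the height into conditions on the three degrees.
include hE in
theorem ht_pos_iff {v : Fin 8 → ℤ} (hv : IsRootVec b α v) (h7 : v 7 = 0)
    (h : ¬ (v 3 = 0 ∧ v 4 = 0)) : 0 < ht v ↔ 0 ≤ v 3 ∧ 0 ≤ v 4 := by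
  revert h7 h
  exact hv.forall b α hE (p := fun v => v 7 = 0 → ¬ (v 3 = 0 ∧ v 4 = 0) →
    (0 < ht v ↔ 0 ≤ v 3 ∧ 0 ≤ v 4)) (by decide +kernel)

include hE in
theorem ht_pos_iff_of_ne {v : Fin 8 → ℤ} (hv : IsRootVec b α v) (h : v 7 ≠ 0) :
    0 < ht v ↔ 0 < v 7 := by
  revert h
  exact hv.forall b α hE (p := fun v => v 7 ≠ 0 → (0 < ht v ↔ 0 < v 7)) (by decide +kernel)

include hS hT hE in
theorem nilPos_eq : nilPos b S T = wtSum b α nilPosSet := by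
  refine rootSum_eq b α (by simp [nilPosSet]) fun β v hv => ?_
  rw [Set.mem_sdiff, Set.mem_inter_iff, mem_rootsOf_left b α hS hv,
    mem_rootsOf_inter b α hS hT hv, posRoots, Set.mem_ofPred_eq, isPos_iff_ht b α hv]
  have := ht_pos_iff b α hE ⟨β, hv⟩
  simp only [nilPosSet, Set.mem_ofPred_eq]
  tauto

include hS hT hE in
theorem nilNeg_eq : nilNeg b S T = wtSum b α nilNegSet := by
  refine rootSum_eq b α (by simp [nilNegSet]) fun β v hv => ?_
  rw [Set.mem_sdiff, Set.mem_inter_iff, mem_rootsOf_right b α hT hv,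
    mem_rootsOf_inter b α hS hT hv, negRoots, Set.mem_ofPred_eq, isPos_iff_ht b α hv]
  have := ht_pos_iff_of_ne b α hE ⟨β, hv⟩
  simp only [nilNegSet, Set.mem_ofPred_eq]
  constructor
  · rintro ⟨⟨h1, h2⟩, h3⟩
    have h7 : v 7 ≠ 0 := fun h => h3 ⟨h2.1, h2.2, h⟩
    rw [this h7] at h1
    exact ⟨h2.1, h2.2, by omega⟩
  · rintro ⟨h1, h2, h3⟩
    rw [this h3.ne]
    exact ⟨⟨by omega, h1, h2⟩, by omega⟩

include hS hT hE in
theorem nilradical_eq : nilradical b S T = wtSum b α (nilPosSet ∪ nilNegSet) := by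
  rw [nilradical, nilPos_eq b α hE hS hT, nilNeg_eq b α hE hS hT, wtSum_union]

include hS hT hE in
theorem parabolicPart_eq : parabolicPart b S T = wtSum b α parabolicSet := by
  rw [parabolicPart, nilPos_eq b α hE hS hT, levi_eq b α hS hT, ← wtSum_union]
  congr 1
  ext v
  simp only [leviSet, nilPosSet, parabolicSet, Set.mem_union, Set.mem_ofPred_eq]
  omega

theorem parabolicPos_eq (U : Set b.support) : (parabolicPos b U).toSubmodule =
    wtSum b α {v | (∀ i, α i ∉ U → v i = 0) ∨ 0 < ht v} := by
  refine cartan_sup_rootSum_eq b α (by simp) fun β v hv => ?_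
  rw [Set.mem_union, mem_rootsOf_iff b α hv, posRoots, Set.mem_ofPred_eq, isPos_iff_ht b α hv]
  rfl

theorem parabolicNeg_eq (U : Set b.support) : (parabolicNeg b U).toSubmodule =
    wtSum b α {v | (∀ i, α i ∉ U → v i = 0) ∨ ¬ 0 < ht v} := by
  refine cartan_sup_rootSum_eq b α (by simp) fun β v hv => ?_
  rw [Set.mem_union, mem_rootsOf_iff b α hv, negRoots, Set.mem_ofPred_eq, isPos_iff_ht b α hv]
  rfl

include hS hT hE in
theorem seaweed_eq : (seaweed b S T).toSubmodule = wtSum b α (parabolicSet ∪ nilNegSet) := by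
  have h : (seaweed b S T).toSubmodule =
      (parabolicNeg b S).toSubmodule ⊓ (parabolicPos b T).toSubmodule := rfl
  rw [h, parabolicNeg_eq b α, parabolicPos_eq b α, ← wtSum_inter]
  refine wtSum_congr b α fun v hv => ?_
  simp only [Set.mem_inter_iff, Set.mem_union, Set.mem_ofPred_eq,
    forall_notMem_left b α hS, forall_notMem_right b α hT, parabolicSet, nilNegSet]
  rcases hv with rfl | hv
  · simp
  have h3 := ht_pos_iff b α hE hv
  have h4 := ht_pos_iff_of_ne b α hE hv
  by_cases h7 : v 7 = 0
  · by_cases h34 : v 3 = 0 ∧ v 4 = 0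
    · simp [h7, h34]
    · rw [h3 h7 h34]; omega
  · rw [h4 h7]; omega

end Identification

end Seaweed

/-! ### Borel subalgebras and the seaweed property. -/

namespace Seaweed

section General

variable {k g : Type*} [Field k] [CharZero k] [LieRing g] [LieAlgebra k g]

/-- In characteristic zero sl₂ is perfect, so the triple survives in every term of the derived
series. -/
theorem not_isSolvable_of_isSl2Triple {B : LieSubalgebra k g} {h e f : g}
    (t : IsSl2Triple h e f) (he : e ∈ B) (hf : f ∈ B) : ¬ IsSolvable B := by
  have hh : h ∈ B := t.lie_e_f ▸ B.lie_mem he hf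
  let e' : B := ⟨e, he⟩
  let f' : B := ⟨f, hf⟩
  let h' : B := ⟨h, hh⟩
  have hef : ⁅e', f'⁆ = h' := Subtype.ext t.lie_e_f
  have hhe : (2⁻¹ : k) • ⁅h', e'⁆ = e' := Subtype.ext (by
    change (2⁻¹ : k) • ⁅h, e⁆ = e
    rw [t.lie_h_e_smul k, smul_smul, inv_mul_cancel₀ two_ne_zero, one_smul])
  have hhf : (-2⁻¹ : k) • ⁅h', f'⁆ = f' := Subtype.ext (by
    change (-2⁻¹ : k) • ⁅h, f⁆ = f
    rw [t.lie_lie_smul_f k, smul_neg, neg_smul, neg_neg, smul_smul,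
      inv_mul_cancel₀ two_ne_zero, one_smul])
  have key : ∀ n, e' ∈ derivedSeries k B n ∧ f' ∈ derivedSeries k B n ∧
      h' ∈ derivedSeries k B n := by
    intro n
    induction n with
    | zero => exact ⟨LieSubmodule.mem_top _, LieSubmodule.mem_top _, LieSubmodule.mem_top _⟩
    | succ n ih =>
      obtain ⟨h1, h2, h3⟩ := ih
      rw [derivedSeries_def, derivedSeriesOfIdeal_succ, ← derivedSeries_def]
      refine ⟨?_, ?_, ?_⟩
      · rw [← hhe]; exact SMulMemClass.smul_mem _ (LieSubmodule.lie_mem_lie h3 h1)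
      · rw [← hhf]; exact SMulMemClass.smul_mem _ (LieSubmodule.lie_mem_lie h3 h2)
      · rw [← hef]; exact LieSubmodule.lie_mem_lie h1 h2
  intro hs
  obtain ⟨n, hn⟩ := (isSolvable_iff k B).1 hs
  have h1 := (key n).1
  rw [hn, LieSubmodule.mem_bot] at h1
  exact t.e_ne_zero (congrArg Subtype.val h1)

end General

variable {k g : Type*} [Field k] [CharZero k] [LieRing g] [LieAlgebra k g] [FiniteDimensional k g]
  [IsKilling k g] {H : LieSubalgebra k g} [H.IsCartanSubalgebra]
  [LieModule.IsTriangularizable k H g]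

section Borel

variable (b : (rootSystem H).Base) (α : Fin 8 ≃ b.support)
  (hE : ∀ i j : Fin 8, b.cartanMatrix (α i) (α j) = CartanMatrix.E₈ i j)

include hE

theorem ht_bounds {v : Fin 8 → ℤ} (hv : IsRootVec b α v) : ht v ≠ 0 ∧ ht v < 30 ∧ -30 < ht v :=
  hv.forall b α hE (p := fun v => ht v ≠ 0 ∧ ht v < 30 ∧ -30 < ht v) (by decide +kernel)

/-- The n-th derived ideal has only weights of height at least n, up to the sign `s`. The highest
root of E₈ has height 29, so the 30th is zero. The sign covers the positive and the negative Borel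
subalgebra together. -/
theorem isSolvable_of_ht {B : LieSubalgebra k g} {s : ℤ} (hs : s = 1 ∨ s = -1)
    (hB : B.toSubmodule = wtSum b α {v | 0 ≤ s * ht v}) : IsSolvable B := by
  have key : ∀ n : ℕ, ∀ x ∈ derivedSeries k B n, (x : g) ∈ wtSum b α {v | (n : ℤ) ≤ s * ht v} := by
    intro n
    induction n with
    | zero =>
      intro x _
      rw [Nat.cast_zero, ← hB]
      exact x.2
    | succ n ih =>
      have h1 : (derivedSeries k B (n + 1)).toSubmodule ≤
          (wtSum b α {v | ((n + 1 : ℕ) : ℤ) ≤ s * ht v}).comap B.toSubmodule.subtype := by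
        rw [derivedSeries_def, derivedSeriesOfIdeal_succ, ← derivedSeries_def,
          LieSubmodule.lieIdeal_oper_eq_linear_span', Submodule.span_le]
        rintro _ ⟨x, hx, y, hy, rfl⟩
        refine lie_mem_wtSum_of_ne_zero b α (fun v hv w hw hv0 hw0 _ h0 => ?_) (ih x hx) (ih y hy)
        simp only [Set.mem_ofPred_eq, ht_add] at *
        have hv1 : v = 0 ∨ s * ht v ≠ 0 := hv0.imp_right fun h => by
          have := (ht_bounds b α hE h).1
          rcases hs with rfl | rfl <;> omega
        have hw1 : w = 0 ∨ s * ht w ≠ 0 := hw0.imp_right fun h => by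
          have := (ht_bounds b α hE h).1
          rcases hs with rfl | rfl <;> omega
        rw [mul_add]
        push_cast
        rcases hv1 with rfl | hv1 <;> rcases hw1 with rfl | hw1
        · simp at h0
        · rw [ht_zero] at *; omega
        · rw [ht_zero] at *; omega
        · omega
      exact fun x hx => h1 hx
  refine IsSolvable.mk (R := k) (k := 30) ((LieSubmodule.eq_bot_iff _).2 fun x hx => ?_)
  have h1 : wtSum b α {v | ((30 : ℕ) : ℤ) ≤ s * ht v} ≤ ⊥ := by
    refine wtSum_le b α fun v hv hv0 => ?_
    exfalso
    rcases hv0 with rfl | hv0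
    · simp [ht] at hv
    · have := ht_bounds b α hE hv0
      simp only [Set.mem_ofPred_eq] at hv
      rcases hs with rfl | rfl <;> omega
  exact Subtype.ext ((Submodule.mem_bot k).1 (h1 (key 30 x hx)))

/-- A larger subalgebra `B'` contains `H`, hence is the sum of its intersections with the weight
spaces. If it met a root space outside `B`, then it would contain an sl₂-triple, because the
opposite root space is in `B`. -/
theorem isBorel_of_ht {B : LieSubalgebra k g} {s : ℤ} (hs : s = 1 ∨ s = -1)
    (hB : B.toSubmodule = wtSum b α {v | 0 ≤ s * ht v}) : IsBorel k B := by
  refine ⟨isSolvable_of_ht b α hE hs hB, fun B' hB' hBB' => ?_⟩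
  have hle : ∀ v, 0 ≤ s * ht v → wtSpace b α v ≤ B.toSubmodule := fun v hv => by
    rw [hB]; exact wtSpace_le_wtSum b α hv
  have hH : ∀ x ∈ H, x ∈ B := fun x hx => hle 0 (by simp [ht]) (by rwa [wtSpace_zero])
  let N : LieSubmodule k H g :=
    { B'.toSubmodule with
      lie_mem := fun {h x} hx => B'.lie_mem (hBB' (hH h h.2)) hx }
  have hN : N.toSubmodule ≤ B.toSubmodule := by
    have hN' := congrArg LieSubmodule.toSubmodule
      (LieModule.eq_iSup_inf_genWeightSpace k H g (N := N))
    rw [LieSubmodule.iSup_toSubmodule] at hN'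
    refine hN'.le.trans (iSup_le ?_)
    rintro χ x ⟨hx1, hx2⟩
    change x ∈ B' at hx1
    by_cases hχ : χ.IsZero
    · refine hle 0 (by simp [ht]) ?_
      rw [wtSpace, weightVec_zero]
      rw [hχ.eq] at hx2
      exact hx2
    obtain ⟨v, hv, -⟩ := exists_coords b α (⟨χ, by simpa using hχ⟩ : H.root)
    have hx3 : x ∈ wtSpace b α v := by rw [wtSpace_root b α hv]; exact hx2
    by_cases hsv : 0 ≤ s * ht v
    · exact hle v hsv hx3
    have hx0 : x = 0 := by
      by_contra hx0
      have hr : IsRootVec b α v := ⟨_, hv⟩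
      obtain ⟨t, e, f, htr, he, hf, -⟩ := hr.exists_sl2 b α hE
      obtain ⟨c, rfl⟩ := exists_smul_eq b α hr hx3 hx0 he
      refine not_isSolvable_of_isSl2Triple htr (B'.smul_mem c hx1) (hBB' ?_) hB'
      exact hle (-v) (by rw [ht_neg]; linarith) hf
    rw [hx0]; exact zero_mem _
  exact fun x hx => hN hx

theorem isParabolic_parabolicPos (U : Set b.support) : IsParabolic k (parabolicPos b U) := by
  refine ⟨parabolicPos b ∅, isBorel_of_ht b α hE (s := 1) (Or.inl rfl) ?_, fun x hx => ?_⟩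
  · rw [parabolicPos_eq b α]
    refine wtSum_congr b α fun v hv => ?_
    simp only [Set.mem_empty_iff_false, not_false_eq_true, forall_true_left, Set.mem_ofPred_eq]
    rcases hv with rfl | hv
    · simp [ht]
    · have h1 := (ht_bounds b α hE hv).1
      have h2 : ¬ ∀ i, v i = 0 := fun h => ((isRootVec_iff b α).1 hv).1 (funext h)
      simp only [h2, false_or]
      omega
  · rw [← LieSubalgebra.mem_toSubmodule, parabolicPos_eq b α] at hx ⊢
    refine wtSum_mono b α (fun v hv _ => ?_) hx
    exact hv.imp_left fun h i _ => h i (by simp)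

theorem isParabolic_parabolicNeg (U : Set b.support) : IsParabolic k (parabolicNeg b U) := by
  refine ⟨parabolicNeg b ∅, isBorel_of_ht b α hE (s := -1) (Or.inr rfl) ?_, fun x hx => ?_⟩
  · rw [parabolicNeg_eq b α]
    refine wtSum_congr b α fun v _ => ?_
    simp only [Set.mem_empty_iff_false, not_false_eq_true, forall_true_left, Set.mem_ofPred_eq]
    constructor
    · rintro (h | h)
      · simp [ht, h]
      · omega
    · intro h; right; omega
  · rw [← LieSubalgebra.mem_toSubmodule, parabolicNeg_eq b α] at hx ⊢
    refine wtSum_mono b α (fun v hv _ => ?_) hx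
    exact hv.imp_left fun h i _ => h i (by simp)

theorem isSeaweed_seaweed (S T : Set b.support) : IsSeaweed k (seaweed b S T) := by
  refine ⟨parabolicNeg b S, parabolicPos b T, isParabolic_parabolicNeg b α hE S,
    isParabolic_parabolicPos b α hE T, ?_, rfl⟩
  rw [parabolicNeg_eq b α, parabolicPos_eq b α, ← wtSum_union, eq_top_iff, ← wtSum_univ b α]
  refine wtSum_mono b α fun v _ _ => ?_
  by_cases h : 0 < ht v
  · exact Or.inr (Or.inr h)
  · exact Or.inl (Or.inr h)

end Borel

end Seaweed

/-! ### A Richardson element of the parabolic part. -/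

namespace Seaweed

/-- The codes of seven roots whose root vectors add up to a Richardson element of the parabolic
part. -/
def richardsonCodes : Finset ℕ := {1010000, 10000, 11110000, 110000, 1111100, 1000, 10111110}

/-- A coweight that is one on the root with code `d` and zero on the other elements of
`richardsonCodes`. -/
def richardsonCoweight (d : ℕ) : Fin 8 → ℤ :=
  if d = 1010000 then ![-1, 1, 0, 0, 0, -1, 2, 0]
  else if d = 10000 then ![1, -1, -1, 1, 0, 1, -2, 0]
  else if d = 11110000 then ![1, 0, 0, 0, 0, 0, -1, 0]
  else if d = 110000 then ![-1, 0, 1, 0, 0, -1, 1, 0]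
  else if d = 1111100 then ![0, 0, 0, 0, 0, 1, -1, 0]
  else if d = 1000 then ![0, 0, 0, 0, 1, -1, 0, 0]
  else ![0, 0, 0, 0, 0, 0, 1, 0]

/-- The value of the coweight `c` on the weight `v`. -/
def coweightPairing (v c : Fin 8 → ℤ) : ℤ :=
  v 0 * c 0 + v 1 * c 1 + v 2 * c 2 + v 3 * c 3 + v 4 * c 4 + v 5 * c 5 + v 6 * c 6 + v 7 * c 7

theorem coweightPairing_richardsonCoweight : ∀ d ∈ richardsonCodes, ∀ d' ∈ richardsonCodes,
    coweightPairing (codeVec d') (richardsonCoweight d) = if d' = d then 1 else 0 := by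
  decide +kernel

/-- Half of the value of the quadratic form of type `E₈`. -/
def quad (v : Fin 8 → ℤ) : ℤ :=
  v 0 * v 0 + v 1 * v 1 + v 2 * v 2 + v 3 * v 3 + v 4 * v 4 + v 5 * v 5 + v 6 * v 6 + v 7 * v 7 -
    (v 0 * v 2 + v 2 * v 3 + v 1 * v 3 + v 3 * v 4 + v 4 * v 5 + v 5 * v 6 + v 6 * v 7)

theorem form_self_eq (v : Fin 8 → ℤ) : form v v = 2 * quad v := by
  simp [form, dotProduct, Matrix.mulVec, Fin.sum_univ_eight, CartanMatrix.E₈, quad]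
  ring

/-- The root with code `n` is obtained from the roots with codes in `C`: the difference of `n` and
`d` is a root of the parabolic part, and its sum with any other element of `richardsonCodes` is in
`C` or is not a root. -/
def IsPeelStep (C : List ℕ) (n d : ℕ) : Prop :=
  n ∈ posCodes ∧ d ∈ richardsonCodes ∧
    (∃ m ∈ posCodes, (∀ i, codeVec n i - codeVec d i = codeVec m i) ∨
      ∀ i, codeVec n i - codeVec d i = -codeVec m i) ∧
    (codeVec n 7 - codeVec d 7 = 0 ∧ 0 ≤ codeVec n 3 - codeVec d 3 ∧
      0 ≤ codeVec n 4 - codeVec d 4) ∧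
    ∀ d' ∈ richardsonCodes, d' = d ∨
      (quad (codeVec n - codeVec d + codeVec d') ≠ 1 ∧
        quad (codeVec n - codeVec d + codeVec d') ≠ 0) ∨
      ∃ m ∈ C, ∀ i, (codeVec n - codeVec d + codeVec d') i = codeVec m i

instance (C : List ℕ) (n d : ℕ) : Decidable (IsPeelStep C n d) := by
  unfold IsPeelStep; infer_instance

/-- Every pair of the list is a step with respect to the codes in `C` and in the preceding pairs. -/
def IsPeeling : List ℕ → List (ℕ × ℕ) → Prop
  | _, [] => True
  | C, (n, d) :: l => IsPeelStep C n d ∧ IsPeeling (n :: C) l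

instance decidableIsPeeling : (C : List ℕ) → (l : List (ℕ × ℕ)) → Decidable (IsPeeling C l)
  | _, [] => isTrue trivial
  | C, (n, _) :: l => @instDecidableAnd _ _ _ (decidableIsPeeling (n :: C) l)

/-- The other roots of the nilradical of the parabolic part, in an order in which their root spaces
are obtained. -/
def richardsonSteps : List (ℕ × ℕ) :=
  [(11110, 10111110), (10111000, 10111110), (1011100, 1111100), (1111000, 1111100),
   (10111100, 10111110), (1111110, 1111100), (1100, 1000), (1110000, 1010000),
   (11111110, 10111110), (1110, 1000), (10110000, 10000), (111000, 1000),
   (11121100, 11110000), (11221110, 10111110), (11221100, 1111100), (1121100, 1010000),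
   (11122210, 10111110), (11111000, 1000), (1121110, 1010000), (11222210, 10111110),
   (11232110, 10111110), (11121110, 1010000), (12232100, 1111100), (1122110, 1000),
   (11233210, 10111110), (11122100, 1000), (12232110, 11110000), (11232100, 110000),
   (11222100, 1000), (12232210, 11110000), (12233210, 1111100), (11222110, 1000),
   (11232210, 110000), (12343210, 1111100), (22343210, 10111110), (12243210, 1010000),
   (111110, 10111110), (111100, 1111100), (11111100, 1111100), (11000, 1000), (11100, 10000),
   (1011000, 1000), (1011110, 1010000), (1122210, 1111100), (1121000, 10000),
   (11121000, 1010000), (11221000, 110000), (1122100, 1000), (11122110, 1000)]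

theorem isPeeling_richardsonSteps :
    IsPeeling [1010000, 10000, 11110000, 110000, 1111100, 1000, 10111110] richardsonSteps := by
  decide +kernel

theorem codeVec_mem_nilPosSet : ∀ d ∈ richardsonCodes,
    d ∈ posCodes ∧ codeVec d 7 = 0 ∧ 0 ≤ codeVec d 3 ∧ 0 ≤ codeVec d 4 ∧
      ¬ (codeVec d 3 = 0 ∧ codeVec d 4 = 0) := by
  decide +kernel

/-- Completeness of the computation: the seven roots and the steps exhaust the roots of n⁺, and no
negative root occurs there. -/
theorem mem_richardsonSteps : ∀ n ∈ posCodes,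
    ((codeVec n 7 = 0 ∧ 0 ≤ codeVec n 3 ∧ 0 ≤ codeVec n 4 ∧
      ¬ (codeVec n 3 = 0 ∧ codeVec n 4 = 0)) →
      n ∈ richardsonCodes ∨ n ∈ richardsonSteps.map Prod.fst) ∧
    ¬ (-codeVec n 7 = 0 ∧ 0 ≤ -codeVec n 3 ∧ 0 ≤ -codeVec n 4 ∧
      ¬ (-codeVec n 3 = 0 ∧ -codeVec n 4 = 0)) := by
  decide +kernel

variable {k g : Type*} [Field k] [CharZero k] [LieRing g] [LieAlgebra k g] [FiniteDimensional k g]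
  [IsKilling k g] {H : LieSubalgebra k g} [H.IsCartanSubalgebra]
  [LieModule.IsTriangularizable k H g]

section Existence

variable (b : (rootSystem H).Base) (α : Fin 8 ≃ b.support)
  (hE : ∀ i j : Fin 8, b.cartanMatrix (α i) (α j) = CartanMatrix.E₈ i j)

theorem exists_coweight (c : Fin 8 → ℤ) :
    ∃ h : H, ∀ v, weightVec b α v h = (coweightPairing v c : k) := by
  let F : Dual k (Dual k H) := b.toWeightBasis.constr k fun j => (c (α.symm j) : k)
  refine ⟨(evalEquiv k H).symm F, fun v => ?_⟩
  rw [← Dual.eval_apply, ← evalEquiv_toLinearMap, LinearEquiv.coe_coe,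
    LinearEquiv.apply_symm_apply, weightVec, map_sum]
  have h : ∀ i, F ((rootSystem H).root (α i)) = (c i : k) := by
    intro i
    have := b.toWeightBasis.constr_basis k (fun j => (c (α.symm j) : k)) (α i)
    rw [RootPairing.Base.toWeightBasis_apply, α.symm_apply_apply] at this
    exact this
  simp only [map_zsmul, h]
  rw [Fin.sum_univ_eight, coweightPairing]
  push_cast
  simp only [zsmul_eq_mul]

include hE

theorem not_isRootVec_of_quad {v : Fin 8 → ℤ} (h1 : quad v ≠ 1) (h0 : quad v ≠ 0) :
    ¬ (v = 0 ∨ IsRootVec b α v) := by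
  rintro (rfl | h)
  · exact h0 (by simp [quad])
  · have := form_self b α hE h
    rw [form_self_eq] at this
    omega

/-- Bracketing x with a vector of weight n - d gives an arbitrary vector of weight n from the
summand of x of weight d. The other summands contribute either zero or vectors already known to lie
in `M`. -/
theorem wtSpace_le_of_isPeelStep {e : ℕ → g}
    (he : ∀ d ∈ richardsonCodes, e d ∈ wtSpace b α (codeVec d) ∧ e d ≠ 0) {C : List ℕ}
    {n d : ℕ} (h : IsPeelStep C n d) {M : Submodule k g}
    (hM : (wtSum b α parabolicSet).map
      (LieAlgebra.ad k g (∑ d ∈ richardsonCodes, e d) : g →ₗ[k] g) ≤ M)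
    (hC : ∀ m ∈ C, wtSpace b α (codeVec m) ≤ M) : wtSpace b α (codeVec n) ≤ M := by
  obtain ⟨hn, hd, hm, hp, hd'⟩ := h
  intro z hz
  have hroot : IsRootVec b α (codeVec n - codeVec d) := by
    obtain ⟨m, hm, h | h⟩ := hm
    · rw [show codeVec n - codeVec d = codeVec m from funext h]
      exact isRootVec_codeVec b α hE hm
    · rw [show codeVec n - codeVec d = -codeVec m from funext h]
      exact (isRootVec_codeVec b α hE hm).neg b α hE
  have hsum : codeVec n - codeVec d + codeVec d = codeVec n := sub_add_cancel _ _
  have hdpos : d ∈ posCodes := (codeVec_mem_nilPosSet d hd).1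
  obtain ⟨y, hy, hyz⟩ := exists_lie_eq b α hE hroot (isRootVec_codeVec b α hE hdpos)
    (by rw [hsum]; exact isRootVec_codeVec b α hE hn) (he d hd).1 (he d hd).2 (z := z)
    (by rwa [hsum])
  have hxy : ⁅∑ d ∈ richardsonCodes, e d, y⁆ ∈ M :=
    hM ⟨y, mem_wtSum b α hp hy, rfl⟩
  rw [sum_lie, ← Finset.add_sum_erase _ _ hd, hyz] at hxy
  refine (Submodule.add_mem_iff_left M (Submodule.sum_mem _ fun d' hd1 => ?_)).1 hxy
  rw [Finset.mem_erase] at hd1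
  have h1 := lie_mem_wtSpace b α (he d' hd1.2).1 hy
  rw [add_comm] at h1
  rcases hd' d' hd1.2 with h | ⟨h, h'⟩ | ⟨m, hm, h⟩
  · exact absurd h hd1.1
  · have h2 := not_isRootVec_of_quad b α hE h h'
    rw [not_or] at h2
    rw [wtSpace_eq_bot b α h2.1 h2.2, Submodule.mem_bot] at h1
    rw [h1]; exact zero_mem _
  · rw [show codeVec n - codeVec d + codeVec d' = codeVec m from funext h] at h1
    exact hC m hm h1

theorem wtSpace_le_of_isPeeling {e : ℕ → g}
    (he : ∀ d ∈ richardsonCodes, e d ∈ wtSpace b α (codeVec d) ∧ e d ≠ 0) {M : Submodule k g}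
    (hM : (wtSum b α parabolicSet).map
      (LieAlgebra.ad k g (∑ d ∈ richardsonCodes, e d) : g →ₗ[k] g) ≤ M)
    {l : List (ℕ × ℕ)} : ∀ {C : List ℕ}, IsPeeling C l →
    (∀ m ∈ C, wtSpace b α (codeVec m) ≤ M) →
    ∀ n ∈ l.map Prod.fst, wtSpace b α (codeVec n) ≤ M := by
  induction l with
  | nil => intro C _ _ n hn; simp at hn
  | cons p l ih =>
    obtain ⟨n, d⟩ := p
    rintro C ⟨h1, h2⟩ hC
    have hn := wtSpace_le_of_isPeelStep b α hE he h1 hM hC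
    intro m hm
    rw [List.map_cons, List.mem_cons] at hm
    rcases hm with rfl | hm
    · exact hn
    · exact ih h2 (fun m hm => (List.mem_cons.1 hm).elim (fun h => h ▸ hn) (hC m)) m hm

/-- The element is the sum of one nonzero root vector for each of the seven roots; which vectors are
chosen is immaterial. -/
theorem exists_isRichardson : ∃ x : g, IsRichardson k (wtSum b α parabolicSet)
    (wtSum b α nilPosSet) x := by
  have hex : ∀ d, ∃ y : g, d ∈ richardsonCodes → y ∈ wtSpace b α (codeVec d) ∧ y ≠ 0 := by
    intro d
    by_cases hd : d ∈ richardsonCodes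
    · obtain ⟨y, h1, h2⟩ := exists_ne_zero b α
        (isRootVec_codeVec b α hE (codeVec_mem_nilPosSet d hd).1)
      exact ⟨y, fun _ => ⟨h1, h2⟩⟩
    · exact ⟨0, fun h => absurd h hd⟩
  choose e he using hex
  have hx : ∑ d ∈ richardsonCodes, e d ∈ wtSum b α nilPosSet :=
    Submodule.sum_mem _ fun d hd =>
      mem_wtSum b α (codeVec_mem_nilPosSet d hd).2 (he d hd).1
  refine ⟨∑ d ∈ richardsonCodes, e d, hx, le_antisymm ?_ ?_⟩
  · rintro _ ⟨y, hy, rfl⟩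
    refine lie_mem_wtSum b α (fun v hv w hw _ _ _ => ?_) hx hy
    simp only [nilPosSet, parabolicSet, Set.mem_ofPred_eq, Pi.add_apply] at *
    omega
  · set M := (wtSum b α parabolicSet).map
      (LieAlgebra.ad k g (∑ d ∈ richardsonCodes, e d) : g →ₗ[k] g)
    -- The seven roots have dual coweights, so bracketing with the Cartan subalgebra isolates each
    -- of the seven summands of x.
    have hD : ∀ d ∈ richardsonCodes, wtSpace b α (codeVec d) ≤ M := by
      intro d hd z hz
      obtain ⟨h, hh⟩ := exists_coweight b α (richardsonCoweight d)
      have h1 : ⁅∑ d ∈ richardsonCodes, e d, (h : g)⁆ ∈ M :=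
        ⟨h, mem_wtSum b α (v := 0) (by simp [parabolicSet])
          (by rw [wtSpace_zero]; exact h.2), rfl⟩
      rw [← lie_skew, lie_sum, Finset.sum_eq_single_of_mem d hd, lie_cartan b α (he d hd).1, hh,
        coweightPairing_richardsonCoweight d hd d hd, if_pos rfl, Int.cast_one, one_smul,
        neg_mem_iff] at h1
      · obtain ⟨c, rfl⟩ := exists_smul_eq b α
          (isRootVec_codeVec b α hE (codeVec_mem_nilPosSet d hd).1) (he d hd).1 (he d hd).2 hz
        exact Submodule.smul_mem _ _ h1
      · intro d' hd' hne
        rw [lie_cartan b α (he d' hd').1, hh, coweightPairing_richardsonCoweight d hd d' hd',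
          if_neg hne, Int.cast_zero, zero_smul]
    have hsteps := wtSpace_le_of_isPeeling b α hE he le_rfl isPeeling_richardsonSteps
      (fun m hm => hD m (by simpa [richardsonCodes] using hm))
    refine wtSum_le b α fun v hv hv0 => ?_
    rcases hv0 with rfl | hv0
    · simp [nilPosSet] at hv
    obtain ⟨n, hn, rfl | rfl⟩ := (isRootVec_iff_code b α hE).1 hv0
    · rcases (mem_richardsonSteps n hn).1 hv with h | h
      · exact hD n h
      · exact hsteps n h
    · exact absurd hv (mem_richardsonSteps n hn).2

end Existence

end Seaweed

/-! ### Dimensions of the graded pieces and vanishing of brackets. -/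

namespace Seaweed

/-- The vectors of degree `(a, b, 0)` with respect to `α₄`, `α₅`, `α₈`. -/
def degSet (a b' : ℤ) : Set (Fin 8 → ℤ) := {v | v 3 = a ∧ v 4 = b' ∧ v 7 = 0}

/-- The part of `nilPosSet` outside of the degrees `(1, 0)`, `(0, 1)`, `(1, 1)`. -/
def highSet : Set (Fin 8 → ℤ) :=
  {v | v 7 = 0 ∧ 0 ≤ v 3 ∧ 0 ≤ v 4 ∧ 2 ≤ v 3 + v 4 ∧ ¬ (v 3 = 1 ∧ v 4 = 1)}

theorem finrank_sup_of_disjoint {k g : Type*} [Field k] [AddCommGroup g] [Module k g]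
    [FiniteDimensional k g] {U W : Submodule k g} (h : Disjoint U W) :
    finrank k (U ⊔ W : Submodule k g) = finrank k U + finrank k W := by
  have := Submodule.finrank_sup_add_finrank_inf_eq U W
  rw [h.eq_bot, finrank_bot] at this
  omega

variable {k g : Type*} [Field k] [CharZero k] [LieRing g] [LieAlgebra k g] [FiniteDimensional k g]
  [IsKilling k g] {H : LieSubalgebra k g} [H.IsCartanSubalgebra]
  [LieModule.IsTriangularizable k H g]

section Dimensions

variable (b : (rootSystem H).Base) (α : Fin 8 ≃ b.support)
  (hE : ∀ i j : Fin 8, b.cartanMatrix (α i) (α j) = CartanMatrix.E₈ i j)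

theorem finrank_wtSum_finset (s : Finset (Fin 8 → ℤ)) (hs : ∀ v ∈ s, IsRootVec b α v) :
    finrank k (wtSum b α (s : Set (Fin 8 → ℤ))) = s.card := by
  induction s using Finset.induction_on with
  | empty =>
    have h : wtSum b α ((∅ : Finset (Fin 8 → ℤ)) : Set (Fin 8 → ℤ)) = ⊥ := by
      rw [Finset.coe_empty]; simp [wtSum]
    rw [h, finrank_bot, Finset.card_empty]
  | insert v s hv ih =>
    rw [Finset.coe_insert, Set.insert_eq, wtSum_union, wtSum_singleton, finrank_sup_of_disjoint,
      finrank_wtSpace b α (hs v (Finset.mem_insert_self v s)),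
      ih fun w hw => hs w (Finset.mem_insert_of_mem hw), Finset.card_insert_of_notMem hv, add_comm]
    rw [← wtSum_singleton b α v]
    exact wtSum_disjoint b α (by simpa using hv)

theorem finrank_cartan (b : (rootSystem H).Base) (α : Fin 8 ≃ b.support) :
    finrank k H.toSubmodule = 8 := by
  have h : finrank k (Dual k H) = 8 := by
    rw [finrank_eq_card_basis b.toWeightBasis, ← Fintype.card_congr α, Fintype.card_fin]
  rw [← h, Subspace.dual_finrank_eq]
  rfl

include hE

theorem isRootVec_image {N : Finset ℕ} (hN : ∀ n ∈ N, n ∈ posCodes) :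
    ∀ v ∈ N.image codeVec, IsRootVec b α v := by
  intro v hv
  obtain ⟨n, hn, rfl⟩ := Finset.mem_image.1 hv
  exact isRootVec_codeVec b α hE (hN n hn)

theorem isRootVec_image_neg {N : Finset ℕ} (hN : ∀ n ∈ N, n ∈ posCodes) :
    ∀ v ∈ N.image (fun n => -codeVec n), IsRootVec b α v := by
  intro v hv
  obtain ⟨n, hn, rfl⟩ := Finset.mem_image.1 hv
  exact (isRootVec_codeVec b α hE (hN n hn)).neg b α hE

theorem finrank_levi_le : finrank k (wtSum b α (degSet 0 0)) ≤ 22 := by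
  -- The positive roots of the Levi part, of type A₂ × A₁ × A₂; the bound 22 is 8 + 14.
  let N : Finset ℕ := {10000000, 100000, 10100000, 1000000, 100, 10, 110}
  let s : Finset (Fin 8 → ℤ) := N.image codeVec ∪ N.image fun n => -codeVec n
  have hN : ∀ n ∈ N, n ∈ posCodes := by decide +kernel
  have hs : ∀ v ∈ s, IsRootVec b α v := by
    intro v hv
    rcases Finset.mem_union.1 hv with hv | hv
    · exact isRootVec_image b α hE hN v hv
    · exact isRootVec_image_neg b α hE hN v hv
  have hc : s.card = 14 := by decide +kernel
  have hsub : wtSum b α (degSet 0 0) ≤ H.toSubmodule ⊔ wtSum b α (s : Set (Fin 8 → ℤ)) := by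
    refine wtSum_le b α fun v hv hv0 => ?_
    rcases hv0 with rfl | hv0
    · rw [wtSpace_zero]; exact le_sup_left
    · refine le_trans (wtSpace_le_wtSum b α ?_) le_sup_right
      exact hv0.forall b α hE (p := fun v => (v 3 = 0 ∧ v 4 = 0 ∧ v 7 = 0) → v ∈ s)
        (by decide +kernel) hv
  refine (Submodule.finrank_mono hsub).trans
    ((Submodule.finrank_add_le_finrank_add_finrank _ _).trans ?_)
  rw [finrank_cartan b α, finrank_wtSum_finset b α s hs, hc]

theorem le_finrank_deg_one_one : 18 ≤ finrank k (wtSum b α (degSet 1 1)) := by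
  let N : Finset ℕ := (posCodes.filter fun n => codeVec n 3 = 1 ∧ codeVec n 4 = 1 ∧
    codeVec n 7 = 0).toFinset
  have hN : ∀ n ∈ N, n ∈ posCodes := by decide +kernel
  have hc : (N.image codeVec).card = 18 := by decide +kernel
  rw [← hc, ← finrank_wtSum_finset b α _ (isRootVec_image b α hE hN)]
  refine Submodule.finrank_mono (wtSum_mono b α fun v hv _ => ?_)
  obtain ⟨n, hn, rfl⟩ := Finset.mem_image.1 hv
  have : ∀ n ∈ N, codeVec n 3 = 1 ∧ codeVec n 4 = 1 ∧ codeVec n 7 = 0 := by decide +kernel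
  exact this n hn

theorem le_finrank_deg_zero_neg_one : 3 ≤ finrank k (wtSum b α (degSet 0 (-1))) := by
  let N : Finset ℕ := {1000, 1100, 1110}
  have hN : ∀ n ∈ N, n ∈ posCodes := by decide +kernel
  have hc : (N.image fun n => -codeVec n).card = 3 := by decide +kernel
  rw [← hc, ← finrank_wtSum_finset b α _ (isRootVec_image_neg b α hE hN)]
  refine Submodule.finrank_mono (wtSum_mono b α fun v hv _ => ?_)
  obtain ⟨n, hn, rfl⟩ := Finset.mem_image.1 hv
  have : ∀ n ∈ N, -codeVec n 3 = 0 ∧ -codeVec n 4 = -1 ∧ -codeVec n 7 = 0 := by decide +kernel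
  exact this n hn

theorem finrank_nilNegSet : finrank k (wtSum b α nilNegSet) = 3 := by
  let N : Finset ℕ := {1, 11, 111}
  let s : Finset (Fin 8 → ℤ) := N.image fun n => -codeVec n
  have hN : ∀ n ∈ N, n ∈ posCodes := by decide +kernel
  have hc : s.card = 3 := by decide +kernel
  rw [← hc, ← finrank_wtSum_finset b α _ (isRootVec_image_neg b α hE hN)]
  refine congrArg (fun W : Submodule k g => finrank k W) (wtSum_congr b α fun v hv0 => ?_)
  rcases hv0 with rfl | hv0
  · simp only [nilNegSet, Set.mem_ofPred_eq, Pi.zero_apply, lt_irrefl, and_false, false_iff]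
    decide +kernel
  · exact hv0.forall b α hE (p := fun v => (v 3 = 0 ∧ v 4 = 0 ∧ v 7 < 0) ↔ v ∈ s)
      (by decide +kernel)

end Dimensions

section Degrees

variable (b : (rootSystem H).Base) (α : Fin 8 ≃ b.support)
  (hE : ∀ i j : Fin 8, b.cartanMatrix (α i) (α j) = CartanMatrix.E₈ i j)

theorem lie_cartan_wtSum {A : Set (Fin 8 → ℤ)} {h : H} {c : k}
    (hA : ∀ v ∈ A, (v = 0 ∨ IsRootVec b α v) → weightVec b α v h = c) {x : g}
    (hx : x ∈ wtSum b α A) : ⁅(h : g), x⁆ = c • x := by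
  have h1 : wtSum b α A ≤ LinearMap.ker ((LieAlgebra.ad k g (h : g) : g →ₗ[k] g) -
      c • LinearMap.id) := by
    refine wtSum_le b α fun v hv hv0 y hy => ?_
    rw [LinearMap.mem_ker, LinearMap.sub_apply, LieAlgebra.ad_apply, lie_cartan b α hy,
      hA v hv hv0, LinearMap.smul_apply, LinearMap.id_apply, sub_self]
  have h2 := h1 hx
  rwa [LinearMap.mem_ker, LinearMap.sub_apply, LieAlgebra.ad_apply, LinearMap.smul_apply,
    LinearMap.id_apply, sub_eq_zero] at h2

include hE

theorem exists_code_deg_zero_one {v : Fin 8 → ℤ} (hv : IsRootVec b α v) (h : v ∈ degSet 0 1) :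
    ∃ n ∈ [1000, 1100, 1110], v = codeVec n :=
  hv.forall b α hE (p := fun v => (v 3 = 0 ∧ v 4 = 1 ∧ v 7 = 0) →
    ∃ n ∈ [1000, 1100, 1110], v = codeVec n) (by decide +kernel) h

theorem exists_code_deg_one_zero {v : Fin 8 → ℤ} (hv : IsRootVec b α v) (h : v ∈ degSet 1 0) :
    ∃ n ∈ [10000, 110000, 10110000, 1010000, 1110000, 11110000], v = codeVec n :=
  hv.forall b α hE (p := fun v => (v 3 = 1 ∧ v 4 = 0 ∧ v 7 = 0) →
    ∃ n ∈ [10000, 110000, 10110000, 1010000, 1110000, 11110000], v = codeVec n)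
    (by decide +kernel) h

theorem form_deg_zero_one {v w : Fin 8 → ℤ} (hv : IsRootVec b α v) (hw : IsRootVec b α w)
    (hv1 : v ∈ degSet 0 1) (hw1 : w ∈ degSet 0 1) (hne : v ≠ w) : form v w = 1 := by
  obtain ⟨n, hn, rfl⟩ := exists_code_deg_zero_one b α hE hv hv1
  obtain ⟨m, hm, rfl⟩ := exists_code_deg_zero_one b α hE hw hw1
  have : ∀ n ∈ [1000, 1100, 1110], ∀ m ∈ [1000, 1100, 1110], n = m ∨
      form (codeVec n) (codeVec m) = 1 := by decide +kernel
  exact (this n hn m hm).resolve_left fun h => hne (h ▸ rfl)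

theorem form_deg_one_zero {v w : Fin 8 → ℤ} (hv : IsRootVec b α v) (hw : IsRootVec b α w)
    (hv1 : v ∈ degSet 1 0) (hw1 : w ∈ degSet 0 1) : form v w = -1 := by
  obtain ⟨n, hn, rfl⟩ := exists_code_deg_one_zero b α hE hv hv1
  obtain ⟨m, hm, rfl⟩ := exists_code_deg_zero_one b α hE hw hw1
  have : ∀ n ∈ [10000, 110000, 10110000, 1010000, 1110000, 11110000],
      ∀ m ∈ [1000, 1100, 1110], form (codeVec n) (codeVec m) = -1 := by decide +kernel
  exact this n hn m hm

/-- Distinct roots of degree (0,1) pair to 1, so the vector in question has norm 4 or 6 rather than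
2 or 0. -/
theorem not_root_of_deg_zero_one {u v w : Fin 8 → ℤ} (hu : IsRootVec b α u)
    (hv : IsRootVec b α v) (hw : IsRootVec b α w) (hu1 : u ∈ degSet 0 1)
    (hv1 : v ∈ degSet 0 1) (hw1 : w ∈ degSet 0 1) (huw : u ≠ w) (hvw : v ≠ w) :
    ¬ (u + (v + -w) = 0 ∨ IsRootVec b α (u + (v + -w))) := by
  obtain ⟨n, hn, rfl⟩ := exists_code_deg_zero_one b α hE hu hu1
  obtain ⟨m, hm, rfl⟩ := exists_code_deg_zero_one b α hE hv hv1
  obtain ⟨l, hl, rfl⟩ := exists_code_deg_zero_one b α hE hw hw1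
  have : ∀ n ∈ [1000, 1100, 1110], ∀ m ∈ [1000, 1100, 1110], ∀ l ∈ [1000, 1100, 1110],
      n = l ∨ m = l ∨ (quad (codeVec n + (codeVec m + -codeVec l)) ≠ 1 ∧
        quad (codeVec n + (codeVec m + -codeVec l)) ≠ 0) := by decide +kernel
  rcases this n hn m hm l hl with h | h | h
  · exact absurd (h ▸ rfl) huw
  · exact absurd (h ▸ rfl) hvw
  · exact not_isRootVec_of_quad b α hE h.1 h.2

/-- The difference of `v` and `w` is a root orthogonal to `u`, since `u` pairs to -1 with both; the
sum therefore has norm 4. -/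
theorem not_root_of_deg_one_zero {u v w : Fin 8 → ℤ} (hu : IsRootVec b α u)
    (hv : IsRootVec b α v) (hw : IsRootVec b α w) (hu1 : u ∈ degSet 1 0)
    (hv1 : v ∈ degSet 0 1) (hw1 : w ∈ degSet 0 1) (hvw : v ≠ w) :
    ¬ ((v + -w) + u = 0 ∨ IsRootVec b α ((v + -w) + u)) := by
  obtain ⟨n, hn, rfl⟩ := exists_code_deg_one_zero b α hE hu hu1
  obtain ⟨m, hm, rfl⟩ := exists_code_deg_zero_one b α hE hv hv1
  obtain ⟨l, hl, rfl⟩ := exists_code_deg_zero_one b α hE hw hw1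
  have : ∀ n ∈ [10000, 110000, 10110000, 1010000, 1110000, 11110000],
      ∀ m ∈ [1000, 1100, 1110], ∀ l ∈ [1000, 1100, 1110],
      m = l ∨ (quad ((codeVec m + -codeVec l) + codeVec n) ≠ 1 ∧
        quad ((codeVec m + -codeVec l) + codeVec n) ≠ 0) := by decide +kernel
  rcases this n hn m hm l hl with h | h
  · exact absurd (h ▸ rfl) hvw
  · exact not_isRootVec_of_quad b α hE h.1 h.2

theorem not_root_deg_one_two {v : Fin 8 → ℤ} (h : v ∈ degSet 1 2) :
    ¬ (v = 0 ∨ IsRootVec b α v) := by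
  rintro (rfl | hv)
  · simp [degSet] at h
  · exact hv.forall b α hE (p := fun v => ¬ (v 3 = 1 ∧ v 4 = 2 ∧ v 7 = 0)) (by decide +kernel) h

theorem not_root_deg_zero_two {v : Fin 8 → ℤ} (h : v ∈ degSet 0 2) :
    ¬ (v = 0 ∨ IsRootVec b α v) := by
  rintro (rfl | hv)
  · simp [degSet] at h
  · exact hv.forall b α hE (p := fun v => ¬ (v 3 = 0 ∧ v 4 = 2 ∧ v 7 = 0)) (by decide +kernel) h

theorem not_root_of_sign {v : Fin 8 → ℤ} (h7 : v 7 < 0) (h : 0 < v 3 ∨ 0 < v 4) :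
    ¬ (v = 0 ∨ IsRootVec b α v) := by
  rintro (rfl | hv)
  · simp at h7
  · exact hv.forall b α hE (p := fun v => v 7 < 0 → ¬ (0 < v 3 ∨ 0 < v 4))
      (by decide +kernel) h7 h

theorem nilNeg_deg {v : Fin 8 → ℤ} (h : v ∈ nilNegSet) (hv : v = 0 ∨ IsRootVec b α v) :
    v 7 = -1 := by
  rcases hv with rfl | hv
  · simp [nilNegSet] at h
  · exact hv.forall b α hE (p := fun v => (v 3 = 0 ∧ v 4 = 0 ∧ v 7 < 0) → v 7 = -1)
      (by decide +kernel) h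

/-- A sum of weights would have a negative α₈-coefficient and a positive coefficient at α₄ or α₅,
and no root has mixed signs. -/
theorem lie_nilPos_nilNeg {x y : g} (hx : x ∈ wtSum b α nilPosSet)
    (hy : y ∈ wtSum b α nilNegSet) : ⁅x, y⁆ = 0 := by
  refine lie_eq_zero_of_wtSum b α (fun v hv w hw _ _ => ?_) hx hy
  simp only [nilPosSet, nilNegSet, Set.mem_ofPred_eq] at hv hw
  refine not_root_of_sign b α hE ?_ ?_ <;> simp only [Pi.add_apply] <;> omega

theorem lie_nilNeg_nilNeg {x y : g} (hx : x ∈ wtSum b α nilNegSet)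
    (hy : y ∈ wtSum b α nilNegSet) : ⁅x, y⁆ = 0 := by
  refine lie_eq_zero_of_wtSum b α (fun v hv w hw hv0 hw0 hvw => ?_) hx hy
  have h1 := nilNeg_deg b α hE hv hv0
  have h2 := nilNeg_deg b α hE hw hw0
  have h3 := nilNeg_deg b α hE (v := v + w) (by
    simp only [nilNegSet, Set.mem_ofPred_eq, Pi.add_apply] at *; omega) hvw
  rw [Pi.add_apply] at h3
  omega

/-- The space of brackets of the lowest pieces of degrees `α₅` and `α₈` is at most
one-dimensional. -/
theorem lie_nilNeg_mem {x y : g} (hx : x ∈ wtSum b α nilNegSet)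
    (hy : y ∈ wtSum b α (degSet 0 (-1))) : ⁅x, y⁆ ∈ wtSpace b α (-codeVec 1111) := by
  rw [← wtSum_singleton]
  refine lie_mem_wtSum b α (fun v hv w hw hv0 _ hvw => ?_) hx hy
  have h1 := nilNeg_deg b α hE hv hv0
  rcases hvw with h | h
  · have := congrFun h 7
    simp only [degSet, Set.mem_ofPred_eq, Pi.add_apply, Pi.zero_apply] at *
    omega
  · refine h.forall b α hE (p := fun v => (v 3 = 0 ∧ v 4 = -1 ∧ v 7 = -1) → v = -codeVec 1111)
      (by decide +kernel) ?_
    simp only [nilNegSet, degSet, Set.mem_ofPred_eq, Pi.add_apply] at *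
    omega

end Degrees

end Seaweed

/-! ### The pieces of degree α₅ and -α₅. -/

namespace Seaweed

/-- Rank-nullity for `f` on `p` and on the preimage of `F` in `p`, which have the same kernel. -/
theorem finrank_inf_comap_add {k V : Type*} [Field k] [AddCommGroup V] [Module k V]
    [FiniteDimensional k V] (f : V →ₗ[k] V) {p n F : Submodule k V} (hp : p.map f = n)
    (hF : F ≤ n) : finrank k (p ⊓ F.comap f : Submodule k V) + finrank k n =
      finrank k p + finrank k F := by
  have key : ∀ q : Submodule k V, finrank k (q.map f) +
      finrank k (q ⊓ LinearMap.ker f : Submodule k V) = finrank k q := by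
    intro q
    have h := LinearMap.finrank_range_add_finrank_ker (f.domRestrict q)
    rw [LinearMap.range_domRestrict] at h
    rw [← h, LinearMap.ker_domRestrict, ← Submodule.finrank_map_subtype_eq q,
      Submodule.map_comap_subtype]
  have h1 := key p
  have h2 := key (p ⊓ F.comap f)
  have h3 : (p ⊓ F.comap f).map f = F := by
    rw [← Submodule.map_inf_eq_map_inf_comap, hp, inf_eq_right.2 hF]
  have h4 : p ⊓ F.comap f ⊓ LinearMap.ker f = p ⊓ LinearMap.ker f := by
    rw [inf_assoc, inf_eq_right.2 (LinearMap.ker_le_comap f)]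
  rw [hp] at h1
  rw [h3, h4] at h2
  omega

variable {k g : Type*} [Field k] [CharZero k] [LieRing g] [LieAlgebra k g] [FiniteDimensional k g]
  [IsKilling k g] {H : LieSubalgebra k g} [H.IsCartanSubalgebra]
  [LieModule.IsTriangularizable k H g]

section Centralizer

variable (b : (rootSystem H).Base) (α : Fin 8 ≃ b.support)
  (hE : ∀ i j : Fin 8, b.cartanMatrix (α i) (α j) = CartanMatrix.E₈ i j)

include hE

/-- The scalar τ is the contraction of `v` with `y`. The two identities share it, so the vanishing
of the first bracket for v ≠ 0 forces [v,y] to kill the whole degree (1,0) piece. Both are linear in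
`y`, which may thus be taken in a root space of weight -γ. Writing v = e + v' with `e` of weight γ,
the bracket [e,y] is a multiple of the coroot `t` of γ, which acts by 2 on `e`, by 1 on `v'` and by
-1 on degree (1,0). -/
theorem exists_trace {v y : g} (hv : v ∈ wtSum b α (degSet 0 1))
    (hy : y ∈ wtSum b α (degSet 0 (-1))) :
    ∃ τ : k, ⁅v, ⁅v, y⁆⁆ = (-2 * τ) • v ∧
      ∀ u ∈ wtSum b α (degSet 1 0), ⁅⁅v, y⁆, u⁆ = (-τ) • u := by
  let W : Submodule k g :=
    { carrier := {y | ∃ τ : k, ⁅v, ⁅v, y⁆⁆ = (-2 * τ) • v ∧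
        ∀ u ∈ wtSum b α (degSet 1 0), ⁅⁅v, y⁆, u⁆ = (-τ) • u}
      zero_mem' := ⟨0, by simp⟩
      add_mem' := by
        rintro y y' ⟨τ, h1, h2⟩ ⟨τ', h1', h2'⟩
        refine ⟨τ + τ', ?_, fun u hu => ?_⟩
        · rw [lie_add, lie_add, h1, h1', ← add_smul]; ring_nf
        · rw [lie_add, add_lie, h2 u hu, h2' u hu, ← add_smul]; ring_nf
      smul_mem' := by
        rintro c y ⟨τ, h1, h2⟩
        refine ⟨c * τ, ?_, fun u hu => ?_⟩
        · rw [lie_smul, lie_smul, h1, smul_smul]; ring_nf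
        · rw [lie_smul, smul_lie, h2 u hu, smul_smul]; ring_nf }
  suffices h : wtSum b α (degSet 0 (-1)) ≤ W from h hy
  refine wtSum_le b α fun w hw hw0 y hy => ?_
  rcases hw0 with rfl | hw0
  · simp [degSet] at hw
  obtain ⟨γ, rfl⟩ : ∃ γ, w = -γ := ⟨-w, (neg_neg w).symm⟩
  have hγ : IsRootVec b α γ := by simpa using hw0.neg b α hE
  have hγ1 : γ ∈ degSet 0 1 := by
    simp only [degSet, Set.mem_ofPred_eq, Pi.neg_apply] at hw ⊢; omega
  obtain ⟨t, ht, hs⟩ := hγ.exists_coroot b α hE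
  have hsplit : degSet 0 1 = {γ} ∪ (degSet 0 1 \ {γ}) := by
    rw [Set.union_sdiff_self, Set.union_eq_right.2 (Set.singleton_subset_iff.2 hγ1)]
  rw [hsplit, wtSum_union, wtSum_singleton] at hv
  obtain ⟨e, he, v', hv', rfl⟩ := Submodule.mem_sup.1 hv
  obtain ⟨s, hey⟩ := hs e he y hy
  have hdeg : ∀ δ ∈ degSet 0 1, δ = 0 ∨ IsRootVec b α δ → IsRootVec b α δ := by
    rintro δ hδ (rfl | h)
    · simp [degSet] at hδ
    · exact h
  have hte : ⁅(t : g), e⁆ = (2 : k) • e := by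
    rw [lie_cartan b α he, ht, form_self b α hE hγ]; norm_num
  have htv : ⁅(t : g), v'⁆ = (1 : k) • v' := by
    refine lie_cartan_wtSum b α (fun δ hδ hδ0 => ?_) hv'
    rw [ht, form_deg_zero_one b α hE (hdeg δ hδ.1 hδ0) hγ hδ.1 hγ1 hδ.2, Int.cast_one]
  have hvy : ⁅v', y⁆ ∈ wtSum b α {w | ∃ δ ∈ degSet 0 1 \ {γ}, IsRootVec b α δ ∧ w = δ + -γ} := by
    rw [← wtSum_singleton] at hy
    refine lie_mem_wtSum b α (fun δ hδ w hw hδ0 _ _ => ?_) hv' hy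
    rw [Set.mem_singleton_iff] at hw
    exact ⟨δ, hδ, hdeg δ hδ.1 hδ0, by rw [hw]⟩
  have hvvy : ⁅v', ⁅v', y⁆⁆ = 0 := by
    refine lie_eq_zero_of_wtSum b α (fun δ hδ w hw hδ0 _ => ?_) hv' hvy
    obtain ⟨δ', hδ', hδ'0, rfl⟩ := hw
    exact not_root_of_deg_zero_one b α hE (hdeg δ hδ.1 hδ0) hδ'0 hγ hδ.1 hδ'.1 hγ1 hδ.2 hδ'.2
  have hev : ⁅e, v'⁆ = 0 := by
    rw [← wtSum_singleton] at he
    refine lie_eq_zero_of_wtSum b α (fun δ hδ w hw _ _ => not_root_deg_zero_two b α hE ?_) he hv'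
    rw [Set.mem_singleton_iff] at hδ
    have := hw.1
    subst hδ
    simp only [degSet, Set.mem_ofPred_eq, Pi.add_apply] at *
    omega
  -- This second copy of the term in `v'` makes the coefficient of `v'` equal to that of `e`, so
  -- that the result is a multiple of `v`.
  have hevy : ⁅e, ⁅v', y⁆⁆ = ⁅v', ⁅e, y⁆⁆ := by
    rw [leibniz_lie e v' y, hev, zero_lie, zero_add]
  refine ⟨s, ?_, fun u hu => ?_⟩
  · rw [add_lie e v' y, lie_add, add_lie, add_lie, hvvy, hevy, hey, lie_smul, lie_smul,
      ← lie_skew, ← lie_skew v', hte, htv]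
    module
  · have h1 : ⁅(t : g), u⁆ = (-1 : k) • u := by
      refine lie_cartan_wtSum b α (fun δ hδ hδ0 => ?_) hu
      rcases hδ0 with rfl | hδ0
      · simp [degSet] at hδ
      rw [ht, form_deg_one_zero b α hE hδ0 hγ hδ hγ1, Int.cast_neg, Int.cast_one]
    have h2 : ⁅⁅v', y⁆, u⁆ = 0 := by
      refine lie_eq_zero_of_wtSum b α (fun w hw δ hδ _ hδ0 => ?_) hvy hu
      obtain ⟨δ', hδ', hδ'0, rfl⟩ := hw
      rcases hδ0 with rfl | hδ0
      · simp [degSet] at hδ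
      exact not_root_of_deg_one_zero b α hE hδ0 hδ'0 hγ hδ hδ'.1 hγ1 hδ'.2
    rw [add_lie, add_lie, h2, hey, smul_lie, h1]
    module

omit hE in
theorem nilPosSet_eq : nilPosSet = degSet 1 0 ∪ degSet 0 1 ∪ (degSet 1 1 ∪ highSet) := by
  ext v
  simp only [nilPosSet, degSet, highSet, Set.mem_union, Set.mem_ofPred_eq]
  omega

omit hE in
theorem parabolicSet_eq : parabolicSet = degSet 0 0 ∪ nilPosSet := by
  ext v
  simp only [parabolicSet, nilPosSet, degSet, Set.mem_union, Set.mem_ofPred_eq]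
  omega

omit hE in
theorem lie_mem_of_deg {A B C : Set (Fin 8 → ℤ)} (h : ∀ v ∈ A, ∀ w ∈ B, v + w ∈ C) {x y : g}
    (hx : x ∈ wtSum b α A) (hy : y ∈ wtSum b α B) : ⁅x, y⁆ ∈ wtSum b α C :=
  lie_mem_wtSum b α (fun v hv w hw _ _ _ => h v hv w hw) hx hy

omit hE in
/-- The lowest component of a Richardson element generates the piece of degree `α₅`. -/
theorem exists_lie_eq_of_isRichardson {x v r : g} (hv : v ∈ wtSum b α (degSet 0 1))
    (hr : r ∈ wtSum b α (degSet 1 0 ∪ degSet 1 1 ∪ highSet))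
    (hx : x = v + r) (hR : IsRichardson k (wtSum b α parabolicSet) (wtSum b α nilPosSet) x)
    {z : g} (hz : z ∈ wtSum b α (degSet 0 1)) : ∃ y ∈ wtSum b α (degSet 0 0), ⁅v, y⁆ = z := by
  have hz' : z ∈ wtSum b α nilPosSet := wtSum_mono b α (fun w hw _ => by
    simp only [degSet, nilPosSet, Set.mem_ofPred_eq] at *; omega) hz
  rw [← hR.2] at hz'
  obtain ⟨y, hy, hyz⟩ := hz'
  rw [parabolicSet_eq, wtSum_union] at hy
  obtain ⟨y0, hy0, y1, hy1, rfl⟩ := Submodule.mem_sup.1 hy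
  refine ⟨y0, hy0, ?_⟩
  have h1 : ⁅v, y0⁆ ∈ wtSum b α (degSet 0 1) := lie_mem_of_deg b α (fun v hv w hw => by
    simp only [degSet, Set.mem_ofPred_eq, Pi.add_apply] at *; omega) hv hy0
  have h2 : ⁅v, y1⁆ ∈ wtSum b α (degSet 1 0 ∪ degSet 1 1 ∪ highSet) :=
    lie_mem_of_deg b α (fun v hv w hw => by
      simp only [degSet, nilPosSet, highSet, Set.mem_union, Set.mem_ofPred_eq,
        Pi.add_apply] at *; omega) hv hy1
  have h3 : ⁅r, y0 + y1⁆ ∈ wtSum b α (degSet 1 0 ∪ degSet 1 1 ∪ highSet) := by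
    rw [← wtSum_union, ← parabolicSet_eq] at hy
    exact lie_mem_of_deg b α (fun v hv w hw => by
      simp only [degSet, parabolicSet, highSet, Set.mem_union, Set.mem_ofPred_eq,
        Pi.add_apply] at *; omega) hr hy
  have h4 : z - ⁅v, y0⁆ = ⁅v, y1⁆ + ⁅r, y0 + y1⁆ := by
    rw [← hyz, LieAlgebra.ad_apply, hx, add_lie, lie_add]; abel
  have hd : Disjoint (degSet 0 1) (degSet 1 0 ∪ degSet 1 1 ∪ highSet) := by
    rw [Set.disjoint_left]
    intro v hv hv'
    simp only [degSet, highSet, Set.mem_union, Set.mem_ofPred_eq] at *; omega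
  -- Only the bracket of `v` with the Levi component `y0` contributes to degree (0,1).
  have h5 := Submodule.disjoint_def.1 (wtSum_disjoint b α hd) (z - ⁅v, y0⁆) (sub_mem hz h1)
    (h4 ▸ add_mem h2 h3)
  exact (sub_eq_zero.1 h5).symm

omit hE in
/-- If the bracket with `v` generates the piece of degree `α₅`, then it is injective on the opposite
piece. -/
theorem eq_zero_of_lie_eq_zero {v : g}
    (hR : ∀ z ∈ wtSum b α (degSet 0 1), ∃ y ∈ wtSum b α (degSet 0 0), ⁅v, y⁆ = z)
    {y : g} (hy : y ∈ wtSum b α (degSet 0 (-1))) (h : ⁅v, y⁆ = 0) : y = 0 := by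
  -- By invariance κ(y,[v,w]) = κ([y,v],w) = 0, and the brackets [v,w] fill degree (0,1). The other
  -- weights are orthogonal to `y` by degree, so `y` is in the radical of the Killing form.
  have h1 : wtSum b α (degSet 0 1) ≤ LinearMap.ker (killingForm k g y) := by
    intro z hz
    obtain ⟨w, -, rfl⟩ := hR z hz
    have h2 := LieModule.traceForm_apply_lie_apply k g g y v w
    rw [LinearMap.mem_ker]
    change LieModule.traceForm k g g y ⁅v, w⁆ = 0
    rw [← h2, ← lie_skew, h, neg_zero, map_zero, LinearMap.zero_apply]
  have h2 : wtSum b α (degSet 0 1)ᶜ ≤ LinearMap.ker (killingForm k g y) := by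
    refine wtSum_le b α fun w hw _ z hz => ?_
    have h3 : wtSum b α (degSet 0 (-1)) ≤ LinearMap.ker ((killingForm k g).flip z) := by
      refine wtSum_le b α fun δ hδ _ y hy => ?_
      refine killingForm_apply_eq_zero_of_mem_rootSpace_of_add_ne_zero k g H hy hz fun h0 => ?_
      have h4 : weightVec b α (δ + w) = 0 := by
        rw [weightVec_add]; ext x; exact congrFun h0 x
      rw [← weightVec_zero b α] at h4
      have h5 := weightVec_injective b α h4
      refine hw ?_
      have e3 := congrFun h5 3
      have e4 := congrFun h5 4
      have e7 := congrFun h5 7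
      simp only [degSet, Set.mem_ofPred_eq, Pi.add_apply, Pi.zero_apply] at *
      omega
    exact h3 hy
  have h3 : LinearMap.ker (killingForm k g y) = ⊤ := by
    rw [eq_top_iff, ← wtSum_univ b α, ← Set.union_compl_self (degSet 0 1), wtSum_union]
    exact sup_le h1 h2
  have h4 : y ∈ LinearMap.ker (killingForm k g) := LinearMap.mem_ker.2 (LinearMap.ker_eq_top.1 h3)
  rwa [ker_killingForm_eq_bot, Submodule.mem_bot] at h4

end Centralizer

end Seaweed

/-! ### The Levi components of the centralizer and the bound. -/

namespace Seaweed

variable {k g : Type*} [Field k] [CharZero k] [LieRing g] [LieAlgebra k g] [FiniteDimensional k g]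
  [IsKilling k g] {H : LieSubalgebra k g} [H.IsCartanSubalgebra]
  [LieModule.IsTriangularizable k H g]

omit [CharZero k] [FiniteDimensional k g] [IsKilling k g] in
theorem finrank_span_singleton_le_one (v : g) : finrank k (k ∙ v : Submodule k g) ≤ 1 :=
  (finrank_span_le_card ({v} : Set g)).trans (by simp)

section Main

variable (b : (rootSystem H).Base) (α : Fin 8 ≃ b.support)
  (hE : ∀ i j : Fin 8, b.cartanMatrix (α i) (α j) = CartanMatrix.E₈ i j)

/-- The coweight that is one on `α₈` and zero on the other simple roots. -/
theorem exists_central_coweight : ∃ h : H, ∀ v, weightVec b α v h = (v 7 : k) := by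
  obtain ⟨h, hh⟩ := exists_coweight b α (Pi.single 7 1)
  refine ⟨h, fun v => ?_⟩
  rw [hh]
  congr 1
  simp [coweightPairing]

/-- The elements of the opposite of the piece of degree `α₅` whose bracket with `v` annihilates
`v`. -/
def oppositeKer (v : g) : Submodule k g :=
  wtSum b α (degSet 0 (-1)) ⊓
    LinearMap.ker ((LieAlgebra.ad k g v : g →ₗ[k] g) ∘ₗ (LieAlgebra.ad k g v : g →ₗ[k] g))

include hE

/-- The square of ad v maps a space of dimension at least 3 into the line through `v`. -/
theorem le_finrank_oppositeKer {v : g} (hv : v ∈ wtSum b α (degSet 0 1)) :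
    2 ≤ finrank k (oppositeKer b α v) := by
  let f : g →ₗ[k] g := (LieAlgebra.ad k g v : g →ₗ[k] g) ∘ₗ (LieAlgebra.ad k g v : g →ₗ[k] g)
  have h1 := finrank_inf_comap_add f (p := wtSum b α (degSet 0 (-1))) rfl
    (bot_le : ⊥ ≤ (wtSum b α (degSet 0 (-1))).map f)
  rw [Submodule.comap_bot, finrank_bot, add_zero] at h1
  have h2 : (wtSum b α (degSet 0 (-1))).map f ≤ k ∙ v := by
    rintro _ ⟨y, hy, rfl⟩
    obtain ⟨τ, hτ, -⟩ := exists_trace b α hE hv hy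
    exact Submodule.mem_span_singleton.2 ⟨_, hτ.symm⟩
  have h3 : finrank k ((wtSum b α (degSet 0 (-1))).map f) ≤ 1 :=
    (Submodule.finrank_mono h2).trans (finrank_span_singleton_le_one v)
  have h4 := le_finrank_deg_zero_neg_one b α hE
  have h5 : wtSum b α (degSet 0 (-1)) ⊓ LinearMap.ker f = oppositeKer b α v := rfl
  rw [h5] at h1
  omega

theorem lie_lie_eq_zero {u v y : g} (hu : u ∈ wtSum b α (degSet 1 0))
    (hv : v ∈ wtSum b α (degSet 0 1)) (hv0 : v ≠ 0) (hy : y ∈ oppositeKer b α v) :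
    ⁅v, ⁅v, y⁆⁆ = 0 ∧ ⁅u, ⁅v, y⁆⁆ = 0 := by
  have h1 : ⁅v, ⁅v, y⁆⁆ = 0 := hy.2
  obtain ⟨τ, hτ, hu'⟩ := exists_trace b α hE hv hy.1
  have h2 : τ = 0 := by
    rw [h1, eq_comm, smul_eq_zero] at hτ
    simpa using hτ.resolve_right hv0
  refine ⟨h1, ?_⟩
  rw [← lie_skew, hu' u hu, h2, neg_zero, zero_smul, neg_zero]

/-- The action of the bracket of `v` and `y` on `n⁻`. -/
theorem lie_lie_mem {v y m : g} (hv : v ∈ wtSum b α (degSet 0 1))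
    (hy : y ∈ wtSum b α (degSet 0 (-1))) (hm : m ∈ wtSum b α nilNegSet) :
    ⁅m, ⁅v, y⁆⁆ ∈ (wtSpace b α (-codeVec 1111)).map (LieAlgebra.ad k g v : g →ₗ[k] g) := by
  have hv' : v ∈ wtSum b α nilPosSet := wtSum_mono b α (fun w hw _ => by
    simp only [degSet, nilPosSet, Set.mem_ofPred_eq] at *; omega) hv
  have h1 : ⁅m, v⁆ = 0 := by rw [← lie_skew, lie_nilPos_nilNeg b α hE hv' hm, neg_zero]
  -- As `m` commutes with `v`, the Jacobi identity gives [m,[v,y]] = [v,[m,y]].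
  refine ⟨⁅m, y⁆, lie_nilNeg_mem b α hE hm hy, ?_⟩
  rw [leibniz_lie m v y, h1, zero_lie, zero_add]
  rfl

theorem finrank_map_wtSpace_le (v : g) : finrank k
    ((wtSpace b α (-codeVec 1111)).map (LieAlgebra.ad k g v : g →ₗ[k] g)) ≤ 1 := by
  refine (Submodule.finrank_map_le _ _).trans ?_
  rw [finrank_wtSpace b α ((isRootVec_codeVec b α hE (by decide +kernel)).neg b α hE)]

theorem lie_central_nilNeg {h : H} (hh : ∀ v, weightVec b α v h = (v 7 : k)) {m : g}
    (hm : m ∈ wtSum b α nilNegSet) : ⁅m, (h : g)⁆ = m := by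
  have h1 : ⁅(h : g), m⁆ = (-1 : k) • m := by
    refine lie_cartan_wtSum b α (fun v hv hv0 => ?_) hm
    rw [hh, nilNeg_deg b α hE hv hv0, Int.cast_neg, Int.cast_one]
  rw [← lie_skew, h1, neg_smul, one_smul, neg_neg]

/-- The span of the central coweight and of the brackets of `v` with `oppositeKer`. -/
theorem le_finrank_span_sup {v : g} (hv : v ∈ wtSum b α (degSet 0 1))
    (hR : ∀ z ∈ wtSum b α (degSet 0 1), ∃ y ∈ wtSum b α (degSet 0 0), ⁅v, y⁆ = z)
    {h : H} (hh : ∀ v, weightVec b α v h = (v 7 : k)) :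
    3 ≤ finrank k ((k ∙ (h : g)) ⊔
      (oppositeKer b α v).map (LieAlgebra.ad k g v : g →ₗ[k] g) : Submodule k g) := by
  have hneg := finrank_nilNegSet b α hE
  have h0 : (h : g) ≠ 0 := by
    intro h0
    have : wtSum b α nilNegSet ≤ ⊥ := fun m hm => by
      rw [Submodule.mem_bot, ← lie_central_nilNeg b α hE hh hm, h0, lie_zero]
    have := Submodule.finrank_mono this
    rw [hneg, finrank_bot] at this
    omega
  have h1 : finrank k ((oppositeKer b α v).map (LieAlgebra.ad k g v : g →ₗ[k] g)) =
      finrank k (oppositeKer b α v) := by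
    have h1 := finrank_inf_comap_add (LieAlgebra.ad k g v : g →ₗ[k] g) (p := oppositeKer b α v) rfl
      bot_le
    have h2 : oppositeKer b α v ⊓
        Submodule.comap (LieAlgebra.ad k g v : g →ₗ[k] g) ⊥ = ⊥ := by
      rw [eq_bot_iff]
      rintro y ⟨hy1, hy2⟩
      exact (Submodule.mem_bot k).2 (eq_zero_of_lie_eq_zero b α hR hy1.1 hy2)
    rw [h2, finrank_bot, zero_add, add_zero] at h1
    exact h1
  -- If `h` were some [v,y], then m = [m,h] would lie in a space of dimension at most 1 for every
  -- `m` in n⁻, which has dimension 3.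
  have hd : Disjoint (k ∙ (h : g))
      ((oppositeKer b α v).map (LieAlgebra.ad k g v : g →ₗ[k] g)) := by
    rw [disjoint_comm, Submodule.disjoint_span_singleton' h0]
    rintro ⟨y, hy, hyh⟩
    rw [LieAlgebra.ad_apply] at hyh
    have h2 : wtSum b α nilNegSet ≤
        (wtSpace b α (-codeVec 1111)).map (LieAlgebra.ad k g v : g →ₗ[k] g) := by
      intro m hm
      have := lie_lie_mem b α hE hv hy.1 hm
      rwa [hyh, lie_central_nilNeg b α hE hh hm] at this
    have := (Submodule.finrank_mono h2).trans (finrank_map_wtSpace_le b α hE v)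
    omega
  rw [finrank_sup_of_disjoint hd, h1, finrank_span_singleton h0]
  have := le_finrank_oppositeKer b α hE hv
  omega

/-- The elements `z` of the parabolic part with `[x, z]` in the sum of the high degrees: their Levi
components lie in the span of the central coweight and of the brackets of the lowest component `v`
of `x` with `oppositeKer`. -/
theorem inf_comap_le {x u v w f : g} (hu : u ∈ wtSum b α (degSet 1 0))
    (hv : v ∈ wtSum b α (degSet 0 1)) (hw : w ∈ wtSum b α (degSet 1 1))
    (hf : f ∈ wtSum b α highSet) (hx : x = u + v + (w + f))
    (hR : IsRichardson k (wtSum b α parabolicSet) (wtSum b α nilPosSet) x)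
    {h : H} (hh : ∀ v, weightVec b α v h = (v 7 : k)) :
    wtSum b α parabolicSet ⊓
      (wtSum b α highSet).comap (LieAlgebra.ad k g x : g →ₗ[k] g) ≤
    ((k ∙ (h : g)) ⊔ (oppositeKer b α v).map (LieAlgebra.ad k g v : g →ₗ[k] g)) ⊔
      wtSum b α nilPosSet := by
  set K := wtSum b α parabolicSet ⊓
      (wtSum b α highSet).comap (LieAlgebra.ad k g x : g →ₗ[k] g)
  set M := (k ∙ (h : g)) ⊔ (oppositeKer b α v).map (LieAlgebra.ad k g v : g →ₗ[k] g)
  set n := wtSum b α nilPosSet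
  have hRv : ∀ z ∈ wtSum b α (degSet 0 1), ∃ y ∈ wtSum b α (degSet 0 0), ⁅v, y⁆ = z := by
    intro z hz
    refine exists_lie_eq_of_isRichardson b α hv (r := u + w + f) ?_ (by rw [hx]; abel) hR hz
    rw [wtSum_union, wtSum_union]
    exact Submodule.add_mem_sup (Submodule.add_mem_sup hu hw) hf
  have hv0 : v ≠ 0 := by
    rintro rfl
    obtain ⟨z, hz, hz0⟩ := exists_ne_zero b α (isRootVec_codeVec b α hE (n := 1000) (by decide))
    obtain ⟨y, -, hy⟩ := hRv z (mem_wtSum b α (show codeVec 1000 3 = 0 ∧ codeVec 1000 4 = 1 ∧ codeVec 1000 7 = 0 by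
      decide +kernel) hz)
    rw [zero_lie] at hy
    exact hz0 hy.symm
  have hxn : x ∈ n := hR.1
  have hlevi : wtSum b α parabolicSet = wtSum b α (degSet 0 0) ⊔ n := by
    rw [parabolicSet_eq, wtSum_union]
  have hdlevi : Disjoint (wtSum b α (degSet 0 0)) n := by
    refine wtSum_disjoint b α (Set.disjoint_left.2 fun v hv hv' => ?_)
    simp only [degSet, nilPosSet, Set.mem_ofPred_eq] at *
    omega
  -- Here the Richardson property enters: `K` is the preimage of the high part under a surjection
  -- from the parabolic part onto `n`, and the Levi part accounts for 22.
  have hK : finrank k K ≤ 22 + finrank k (wtSum b α highSet) := by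
    have h1 := finrank_inf_comap_add (LieAlgebra.ad k g x : g →ₗ[k] g) hR.2
      (F := wtSum b α highSet) (wtSum_mono b α fun v hv _ => by
        simp only [highSet, nilPosSet, Set.mem_ofPred_eq] at *; omega)
    have h2 := finrank_levi_le b α hE
    have h3 := finrank_sup_of_disjoint hdlevi
    rw [← hlevi] at h3
    change finrank k K + finrank k n = _ at h1
    omega
  have hEK : wtSum b α (degSet 1 1 ∪ highSet) ≤ K ⊓ n := by
    have hEn : wtSum b α (degSet 1 1 ∪ highSet) ≤ n := wtSum_mono b α fun v hv _ => by
      simp only [highSet, degSet, nilPosSet, Set.mem_union, Set.mem_ofPred_eq] at *; omega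
    refine le_inf (le_inf (hEn.trans (hlevi ▸ le_sup_right)) fun z hz => ?_) hEn
    exact lie_mem_of_deg b α (fun v hv w hw => by
      simp only [highSet, degSet, nilPosSet, Set.mem_union, Set.mem_ofPred_eq,
        Pi.add_apply] at *; omega) hxn hz
  have hwf : w + f ∈ wtSum b α (degSet 1 1 ∪ highSet) := by
    rw [wtSum_union]; exact Submodule.add_mem_sup hw hf
  have huvn : u + v ∈ n := by
    have : u + v = x - (w + f) := by rw [hx]; abel
    rw [this]
    exact sub_mem hxn (hEK hwf).2
  -- The bracket of x with u + v equals that of w + f with u + v, whose total degree is at least 3.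
  have huvK : u + v ∈ K ⊓ n := by
    refine ⟨⟨hlevi ▸ le_sup_right (a := wtSum b α (degSet 0 0)) huvn, ?_⟩, huvn⟩
    change ⁅x, u + v⁆ ∈ wtSum b α highSet
    have h1 : ⁅x, u + v⁆ = ⁅w + f, u + v⁆ := by rw [hx, add_lie, lie_self, zero_add]
    rw [h1]
    exact lie_mem_of_deg b α (fun v hv w hw => by
      simp only [highSet, degSet, nilPosSet, Set.mem_union, Set.mem_ofPred_eq,
        Pi.add_apply] at *; omega) hwf huvn
  have huvm : u + v ∈ wtSum b α (degSet 1 0 ∪ degSet 0 1) := by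
    rw [wtSum_union]; exact Submodule.add_mem_sup hu hv
  have huv0 : u + v ≠ 0 := by
    intro h0
    have h1 : v = -u := by rw [eq_neg_iff_add_eq_zero, add_comm]; exact h0
    have hd : Disjoint (degSet 1 0) (degSet 0 1) := by
      rw [Set.disjoint_left]
      intro v hv hv'
      simp only [degSet, Set.mem_ofPred_eq] at *; omega
    exact hv0 (Submodule.disjoint_def.1 (wtSum_disjoint b α hd) v (h1 ▸ neg_mem hu) hv)
  -- The 19 is 18 from degree (1,1) plus 1 from u + v.
  have hKn : 19 + finrank k (wtSum b α highSet) ≤ finrank k (K ⊓ n : Submodule k g) := by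
    have h1 : Disjoint (wtSum b α (degSet 1 1)) (wtSum b α highSet) := by
      refine wtSum_disjoint b α (Set.disjoint_left.2 fun v hv hv' => ?_)
      simp only [degSet, highSet, Set.mem_ofPred_eq] at *
      omega
    have h2 := finrank_sup_of_disjoint h1
    rw [← wtSum_union] at h2
    have h3 : Disjoint (k ∙ (u + v)) (wtSum b α (degSet 1 1 ∪ highSet)) := by
      rw [disjoint_comm, Submodule.disjoint_span_singleton' huv0]
      intro h4
      have hd : Disjoint (degSet 1 0 ∪ degSet 0 1) (degSet 1 1 ∪ highSet) := by
        rw [Set.disjoint_left]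
        intro v hv hv'
        simp only [degSet, highSet, Set.mem_union, Set.mem_ofPred_eq] at *; omega
      exact huv0 (Submodule.disjoint_def.1 (wtSum_disjoint b α hd) _ huvm h4)
    have h4 := finrank_sup_of_disjoint h3
    rw [finrank_span_singleton huv0] at h4
    have h5 : (k ∙ (u + v)) ⊔ wtSum b α (degSet 1 1 ∪ highSet) ≤ K ⊓ n :=
      sup_le ((Submodule.span_singleton_le_iff_mem _ _).2 huvK) hEK
    have h6 := Submodule.finrank_mono h5
    have h7 := le_finrank_deg_one_one b α hE
    omega
  have hhl : (h : g) ∈ wtSum b α (degSet 0 0) :=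
    mem_wtSum b α (v := 0) (by simp [degSet]) (by rw [wtSpace_zero]; exact h.2)
  have hvyl : ∀ y ∈ wtSum b α (degSet 0 (-1)), ⁅v, y⁆ ∈ wtSum b α (degSet 0 0) := fun y hy =>
    lie_mem_of_deg b α (fun v hv w hw => by
      simp only [degSet, Set.mem_ofPred_eq, Pi.add_apply] at *; omega) hv hy
  have hMl : M ≤ wtSum b α (degSet 0 0) := by
    refine sup_le ((Submodule.span_singleton_le_iff_mem _ _).2 hhl) ?_
    rintro _ ⟨y, hy, rfl⟩
    exact hvyl y hy.1
  have hMK : M ≤ K ⊔ n := by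
    refine sup_le ((Submodule.span_singleton_le_iff_mem _ _).2 ?_) ?_
    · refine Submodule.mem_sup_left ⟨hlevi ▸ Submodule.mem_sup_left hhl, ?_⟩
      change ⁅x, (h : g)⁆ ∈ wtSum b α highSet
      have h1 : ⁅(h : g), x⁆ = (0 : k) • x := by
        refine lie_cartan_wtSum b α (fun v hv _ => ?_) hxn
        rw [hh, hv.1, Int.cast_zero]
      rw [← lie_skew, h1, zero_smul, neg_zero]
      exact zero_mem _
    · rintro _ ⟨y, hy, rfl⟩
      have hwy : ⁅w, y⁆ ∈ wtSum b α (degSet 1 0) := lie_mem_of_deg b α (fun v hv w hw => by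
        simp only [degSet, Set.mem_ofPred_eq, Pi.add_apply] at *; omega) hw hy.1
      have hwyn : ⁅w, y⁆ ∈ n := wtSum_mono b α (fun v hv _ => by
        simp only [degSet, nilPosSet, Set.mem_ofPred_eq] at *; omega) hwy
      -- The bracket of x with [v,y] may have the component [w,[v,y]] in degree (1,1). As w commutes
      -- with v, this equals [v,[w,y]], so subtracting [w,y], an element of `n`, cancels it.
      have hsum : ⁅v, y⁆ = (⁅v, y⁆ - ⁅w, y⁆) + ⁅w, y⁆ := by abel
      rw [LieAlgebra.ad_apply, hsum]
      refine Submodule.add_mem_sup ⟨hlevi ▸ sub_mem (Submodule.mem_sup_left (hvyl y hy.1))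
        (Submodule.mem_sup_right hwyn), ?_⟩ hwyn
      change ⁅x, ⁅v, y⁆ - ⁅w, y⁆⁆ ∈ wtSum b α highSet
      obtain ⟨h1, h2⟩ := lie_lie_eq_zero b α hE hu hv hv0 hy
      have hwv : ⁅w, v⁆ = 0 := by
        refine lie_eq_zero_of_wtSum b α (fun v hv w hw _ _ => not_root_deg_one_two b α hE ?_) hw hv
        simp only [degSet, Set.mem_ofPred_eq, Pi.add_apply] at *; omega
      have h3 : ⁅w, ⁅v, y⁆⁆ = ⁅v, ⁅w, y⁆⁆ := by rw [leibniz_lie w v y, hwv, zero_lie, zero_add]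
      have h4 : ⁅x, ⁅v, y⁆ - ⁅w, y⁆⁆ = ⁅f, ⁅v, y⁆⁆ - ⁅u + (w + f), ⁅w, y⁆⁆ := by
        rw [hx]
        simp only [lie_sub, add_lie, h1, h2, h3]
        abel
      rw [h4]
      refine sub_mem ?_ ?_
      · exact lie_mem_of_deg b α (fun v hv w hw => by
          simp only [degSet, highSet, Set.mem_ofPred_eq, Pi.add_apply] at *; omega)
          hf (hvyl y hy.1)
      · have h5 : u + (w + f) ∈ wtSum b α (degSet 1 0 ∪ (degSet 1 1 ∪ highSet)) := by
          rw [wtSum_union]; exact Submodule.add_mem_sup hu hwf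
        exact lie_mem_of_deg b α (fun v hv w hw => by
          simp only [degSet, highSet, Set.mem_union, Set.mem_ofPred_eq, Pi.add_apply] at *; omega)
          h5 hwy
  have hfin := Submodule.finrank_sup_add_finrank_inf_eq K n
  have hM := le_finrank_span_sup b α hE hv hRv hh
  have hMn := finrank_sup_of_disjoint (hdlevi.mono_left hMl)
  have hle : M ⊔ n ≤ K ⊔ n := sup_le hMK le_sup_right
  -- The dimension of K + n is at most dim n + 22 - 19, and that of M + n is at least dim n + 3.
  have heq : M ⊔ n = K ⊔ n := Submodule.eq_of_le_of_finrank_le hle (by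
    change 3 ≤ finrank k M at hM
    omega)
  rw [heq]
  exact le_sup_left

theorem finrank_map_centralizerIn_le {x y : g}
    (hR : IsRichardson k (wtSum b α parabolicSet) (wtSum b α nilPosSet) x)
    (hy : y ∈ wtSum b α nilNegSet) :
    finrank k ((centralizerIn (wtSum b α (parabolicSet ∪ nilNegSet)) x).map
      (LieAlgebra.ad k g y : g →ₗ[k] g)) ≤ 2 := by
  have hxn := hR.1
  rw [nilPosSet_eq, wtSum_union, wtSum_union, wtSum_union] at hxn
  obtain ⟨uv, huv, wf, hwf, hx⟩ := Submodule.mem_sup.1 hxn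
  obtain ⟨u, hu, v, hv, rfl⟩ := Submodule.mem_sup.1 huv
  obtain ⟨w, hw, f, hf, rfl⟩ := Submodule.mem_sup.1 hwf
  obtain ⟨h, hh⟩ := exists_central_coweight b α
  have hle := inf_comap_le b α hE hu hv hw hf hx.symm hR hh
  -- Components in n⁺ and n⁻ commute with `y`; the multiple of `h` yields a multiple of `y`, and the
  -- bracket [v,y'] yields an element of the second summand.
  have key : (centralizerIn (wtSum b α (parabolicSet ∪ nilNegSet)) x).map
      (LieAlgebra.ad k g y : g →ₗ[k] g) ≤ (k ∙ y) ⊔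
        (wtSpace b α (-codeVec 1111)).map (LieAlgebra.ad k g v : g →ₗ[k] g) := by
    rintro _ ⟨z, ⟨hz, hxz⟩, rfl⟩
    rw [SetLike.mem_coe, wtSum_union] at hz
    obtain ⟨p, hp, m, hm, rfl⟩ := Submodule.mem_sup.1 hz
    have hxm := lie_nilPos_nilNeg b α hE hR.1 hm
    have hxp : ⁅x, p⁆ = 0 := by
      have : ⁅x, p + m⁆ = 0 := hxz
      rwa [lie_add, hxm, add_zero] at this
    obtain ⟨q, hq, n, hn, rfl⟩ := Submodule.mem_sup.1 (hle ⟨hp, by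
      change ⁅x, p⁆ ∈ wtSum b α highSet
      rw [hxp]; exact zero_mem _⟩)
    have h1 : ⁅y, n⁆ = 0 := by
      rw [← lie_skew, lie_nilPos_nilNeg b α hE hn hy, neg_zero]
    have h2 := lie_nilNeg_nilNeg b α hE hy hm
    rw [LieAlgebra.ad_apply, lie_add, lie_add, h1, h2, add_zero, add_zero]
    obtain ⟨c, hc, _, ⟨y', hy', rfl⟩, rfl⟩ := Submodule.mem_sup.1 hq
    obtain ⟨a, rfl⟩ := Submodule.mem_span_singleton.1 hc
    rw [lie_add, lie_smul, lie_central_nilNeg b α hE hh hy]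
    exact Submodule.add_mem_sup (Submodule.smul_mem _ _ (Submodule.mem_span_singleton_self y))
      (lie_lie_mem b α hE hv hy'.1 hy)
  refine (Submodule.finrank_mono key).trans
    ((Submodule.finrank_add_le_finrank_add_finrank _ _).trans ?_)
  have h1 := finrank_span_singleton_le_one (k := k) y
  have h2 := finrank_map_wtSpace_le b α hE v
  omega

/-- Write x = u + y with u in n⁺ and y in n⁻. The Richardson equation would make u Richardson in the
parabolic part and make y map the centralizer of u onto n⁻, of dimension 3, against the bound 2. -/
theorem not_isRichardson (x : g) : ¬ IsRichardson k (wtSum b α (parabolicSet ∪ nilNegSet))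
    (wtSum b α (nilPosSet ∪ nilNegSet)) x := by
  rintro ⟨hx, hR⟩
  rw [wtSum_union] at hx
  obtain ⟨u, hu, y, hy, rfl⟩ := Submodule.mem_sup.1 hx
  have hup : ∀ p ∈ wtSum b α parabolicSet, ⁅u, p⁆ ∈ wtSum b α nilPosSet := fun p hp =>
    lie_mem_of_deg b α (fun v hv w hw => by
      simp only [nilPosSet, parabolicSet, Set.mem_ofPred_eq, Pi.add_apply] at *; omega) hu hp
  have hyp : ∀ p ∈ wtSum b α parabolicSet, ⁅y, p⁆ ∈ wtSum b α nilNegSet := fun p hp => by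
    refine lie_mem_wtSum b α (fun v hv w hw _ _ hvw => ?_) hy hp
    by_contra h0
    refine not_root_of_sign b α hE ?_ ?_ hvw <;>
    · simp only [nilNegSet, parabolicSet, Set.mem_ofPred_eq, Pi.add_apply] at *; omega
  have hd : Disjoint (wtSum b α nilPosSet) (wtSum b α nilNegSet) := by
    refine wtSum_disjoint b α (Set.disjoint_left.2 fun v hv hv' => ?_)
    simp only [nilPosSet, nilNegSet, Set.mem_ofPred_eq] at *
    omega
  -- The n⁻-component of a preimage commutes with both u and y, so it can be dropped; the equation
  -- then splits along n⁺ ⊕ n⁻. Taking c = 0 gives the Richardson property of u, taking a = 0 the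
  -- surjectivity onto n⁻.
  have hsurj : ∀ a ∈ wtSum b α nilPosSet, ∀ c ∈ wtSum b α nilNegSet,
      ∃ p ∈ wtSum b α parabolicSet, ⁅u, p⁆ = a ∧ ⁅y, p⁆ = c := by
    intro a ha c hc
    have hac : a + c ∈ wtSum b α (nilPosSet ∪ nilNegSet) := by
      rw [wtSum_union]; exact Submodule.add_mem_sup ha hc
    rw [← hR] at hac
    obtain ⟨z, hz, hzac⟩ := hac
    rw [wtSum_union] at hz
    obtain ⟨p, hp, m, hm, rfl⟩ := Submodule.mem_sup.1 hz
    have h1 : ⁅u, p⁆ + ⁅y, p⁆ = a + c := by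
      rw [← hzac, LieAlgebra.ad_apply, lie_add, add_lie, add_lie,
        lie_nilPos_nilNeg b α hE hu hm, lie_nilNeg_nilNeg b α hE hy hm, add_zero, add_zero]
    have h2 : ⁅u, p⁆ - a = c - ⁅y, p⁆ := by
      rw [sub_eq_sub_iff_add_eq_add, h1, add_comm]
    have h3 := Submodule.disjoint_def.1 hd _ (sub_mem (hup p hp) ha)
      (h2 ▸ sub_mem hc (hyp p hp))
    refine ⟨p, hp, sub_eq_zero.1 h3, ?_⟩
    rw [h3, eq_comm, sub_eq_zero] at h2
    exact h2.symm
  have hRu : IsRichardson k (wtSum b α parabolicSet) (wtSum b α nilPosSet) u := by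
    refine ⟨hu, le_antisymm ?_ fun a ha => ?_⟩
    · rintro _ ⟨p, hp, rfl⟩
      exact hup p hp
    · obtain ⟨p, hp, h1, -⟩ := hsurj a ha 0 (zero_mem _)
      exact ⟨p, hp, h1⟩
  have h1 := finrank_map_centralizerIn_le b α hE hRu hy
  have h2 : wtSum b α nilNegSet ≤ (centralizerIn (wtSum b α (parabolicSet ∪ nilNegSet)) u).map
      (LieAlgebra.ad k g y : g →ₗ[k] g) := by
    intro c hc
    obtain ⟨p, hp, h1, h2⟩ := hsurj 0 (zero_mem _) c hc
    refine ⟨p, ⟨?_, h1⟩, h2⟩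
    rw [SetLike.mem_coe, wtSum_union]
    exact Submodule.mem_sup_left hp
  have h3 := Submodule.finrank_mono h2
  rw [finrank_nilNegSet b α hE] at h3
  omega

end Main

end Seaweed

end

theorem mainTheorem4 {k g : Type*} [Field k] [IsAlgClosed k] [CharZero k]
    [LieRing g] [LieAlgebra k g] [FiniteDimensional k g] [LieAlgebra.IsSimple k g]
    (H : LieSubalgebra k g) [H.IsCartanSubalgebra]
    (b : (LieAlgebra.IsKilling.rootSystem H).Base) (α : Fin 8 ≃ b.support)
    (hE₈ : ∀ i j : Fin 8, b.cartanMatrix (α i) (α j) = CartanMatrix.E₈ i j)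
    (S T : Set b.support) (hS : S = Set.univ \ {α 7}) (hT : T = Set.univ \ {α 3, α 4}) :
    Seaweed.IsSeaweed k (Seaweed.seaweed b S T) ∧
    (¬ ∃ x : g, Seaweed.IsRichardson k (Seaweed.seaweed b S T).toSubmodule
      (Seaweed.nilradical b S T) x) ∧
    Module.finrank k (Seaweed.nilNeg b S T) = 3 ∧
    (∃ x : g, Seaweed.IsRichardson k (Seaweed.parabolicPart b S T) (Seaweed.nilPos b S T) x) ∧
    (∀ x : g, Seaweed.IsRichardson k (Seaweed.parabolicPart b S T) (Seaweed.nilPos b S T) x →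
      ∀ y ∈ Seaweed.nilNeg b S T,
        Module.finrank k ((Seaweed.centralizerIn (Seaweed.seaweed b S T).toSubmodule x).map
          (LieAlgebra.ad k g y : g →ₗ[k] g)) ≤ 2) := by
  refine ⟨Seaweed.isSeaweed_seaweed b α hE₈ S T, ?_, ?_, ?_, ?_⟩
  · rintro ⟨x, hx⟩
    rw [Seaweed.seaweed_eq b α hE₈ hS hT, Seaweed.nilradical_eq b α hE₈ hS hT] at hx
    exact Seaweed.not_isRichardson b α hE₈ x hx
  · rw [Seaweed.nilNeg_eq b α hE₈ hS hT]
    exact Seaweed.finrank_nilNegSet b α hE₈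
  · rw [Seaweed.parabolicPart_eq b α hE₈ hS hT, Seaweed.nilPos_eq b α hE₈ hS hT]
    exact Seaweed.exists_isRichardson b α hE₈
  · intro x hx y hy
    rw [Seaweed.parabolicPart_eq b α hE₈ hS hT, Seaweed.nilPos_eq b α hE₈ hS hT] at hx
    rw [Seaweed.nilNeg_eq b α hE₈ hS hT] at hy
    rw [Seaweed.seaweed_eq b α hE₈ hS hT]
    exact Seaweed.finrank_map_centralizerIn_le b α hE₈ hx hy
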